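/- **Setting.** Let $K$ be a field of characteristic $0$, let $P,Q$ be non-zero integers, $b=P/Q$, and let $A\in K^\times$ be an element with a fixed $Q$-th root $A^{1/Q}\in K^\times$; powers of $A$ with exponent in $\frac1Q\mathbb Z$ are powers of $A^{1/Q}$. Let $u$ be a formal variable, $\zeta(z)=e^{z/2}-e^{-z/2}$ and $p_i^*=(A^i-A^{-i})/\zeta(iu/b)\in K((u))$. On the semi-infinite wedge space (with basis the wedges $\underline{i_1}\wedge\underline{i_2}\wedge\cdots$ of decreasing sequences of half-integers with $i_k+k$ eventually constant) let $\psi_k$ be the operator of left multiplication by $\underline k$, $\psi_k^*$ its adjoint, and $E_{i,j}=\psi_i\psi_j^*$ if $j>0$, $E_{i,j}=-\psi_j^*\psi_i$ if $j<0$. Put $$\mathcal E_n(z)=\sum_{k\in\mathbb Z+1/2}e^{z(k-n/2)}E_{k-n,k}+\frac{\delta_{n,0}}{\zeta(z)},$$ and for $m\in\mathbb Z_{\ge1}$ $$\widetilde{\mathcal A}(m,um)=\frac{A^{bm}}{m}\sum_{k=0}^\infty\mathcal E_{k-m}(um)\sum_{\lambda\vdash k}\prod_{i=1}^{\ell(\lambda)}\frac{\left(\frac{p_i^*}{i}\zeta(ium)\right)^{\lambda_i-\lambda_{i+1}}}{(\lambda_i-\lambda_{i+1})!}.$$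 Let $\mathcal P_n^{(\alpha,\beta)}$ be the Jacobi polynomials ($\mathcal P_{-1}^{(\alpha,\beta)}=0$) and $$\xi^1_m=(-1)^mA^{(b-1)m}\mathcal P_{m-1}^{(m(b-1),1)}(1-2A^2),\qquad \xi^2_m=(-1)^mA^{(b-1)m}\mathcal P_{m-2}^{(m(b-1)+1,1)}(1-2A^2).$$ **Proposition.** For every $m\ge1$ there are unique $\mathfrak A_0(m,u),\mathfrak A_{l,s}(m,u)\in K((u))$ with $$\widetilde{\mathcal A}(m,um)=\mathfrak A_0(m,u)\,\mathrm{Id}+\sum_{l\in\mathbb Z+1/2}\ \sum_{s\in\mathbb Z}\mathfrak A_{l,s}(m,u)\,E_{l-s,l}.$$ The coefficients $[u^k]\mathfrak A_{l,s}$ vanish for $k<0$, and $[u^k]\mathfrak A_0$ vanish for $k<-1$. For all $l\in\mathbb Z+\frac12$, $s\in\mathbb Z$ and $k\ge0$ there are polynomials in $m$ with coefficients in $K$, namely $F^1_{k,l}(m,s),F^2_{k,l}(m,s)$ (for $s\ge0$), $\widetilde F^1_{k,l}(m,s),\widetilde F^2_{k,l}(m,s)$ (for $s<0$), of degree at most $9k+2+|s|$,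 and for all $k\ge-1$ there are polynomials $\check F^1_k(m),\check F^2_k(m)$, of degree at most $9k+2$ if $k\ge0$ and constant if $k=-1$, such that $$[u^k]\mathfrak A_{l,s}=\frac{F^1_{k,l}(m,s)\,\xi^1_m+F^2_{k,l}(m,s)\,\xi^2_m}{(m+1)\cdots(m+s)}\qquad(s\ge0,\ (s,k)\ne(0,0),\ m\ge1),$$ $$[u^0]\mathfrak A_{l,0}=\frac{F^1_{0,l}(m,0)\,\xi^1_m+F^2_{0,l}(m,0)\,\xi^2_m}{m}\qquad(m\ge1),$$ $$[u^k]\mathfrak A_{l,s}=\frac{\widetilde F^1_{k,l}(m,s)\,\xi^1_m+\widetilde F^2_{k,l}(m,s)\,\xi^2_m}{(m-1)(m-2)\cdots(m+s+1)\,(m+s)^2}\qquad(s<0,\ m>-s),$$ $$[u^k]\mathfrak A_0=\frac{\check F^1_k(m)\,\xi^1_m+\check F^2_k(m)\,\xi^2_m}{m^2}\qquad(k\ge-1,\ m\ge1).$$ -/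

import Mathlib

open Polynomial

noncomputable section

namespace AOp

/-! Half-integers are encoded by integers: `j : ℤ` stands for the half-integer `j + 1/2`.
So `0 ≤ j` means that the half-integer is positive, and `i - j` is the difference of the
half-integers encoded by `i` and `j`. -/

/-- The basis vectors of the semi-infinite wedge space (all charges). A decreasing sequence
`i₁ > i₂ > ⋯` of half-integers with `i_k + k - 1/2` eventually constant is recorded by the set of its
entries: a set containing finitely many positive and missing finitely many negative half-integers. -/
@[ext] structure Maya where
  /-- the set of wedge factors -/
  occ : Set ℤ
  finite_pos : (occ ∩ Set.Ici 0).Finite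
  finite_neg : (Set.Iio 0 \ occ).Finite

/-- Adjoin the factor `k`. -/
def Maya.insert (k : ℤ) (S : Maya) : Maya where
  occ := Insert.insert k S.occ
  finite_pos := (S.finite_pos.union (Set.finite_singleton k)).subset (by
    rintro x ⟨rfl | hx, h0⟩
    · exact Or.inr rfl
    · exact Or.inl ⟨hx, h0⟩)
  finite_neg := S.finite_neg.subset (fun _ hx => ⟨hx.1, fun h => hx.2 (Or.inr h)⟩)

/-- Remove the factor `k`. -/
def Maya.erase (k : ℤ) (S : Maya) : Maya where
  occ := S.occ \ {k}
  finite_pos := S.finite_pos.subset (fun _ hx => ⟨hx.1.1, hx.2⟩)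
  finite_neg := (S.finite_neg.union (Set.finite_singleton k)).subset (by
    rintro x ⟨h0, hx⟩
    by_cases hk : x = k
    · exact Or.inr hk
    · exact Or.inl ⟨h0, fun h => hx ⟨h, hk⟩⟩)

/-- The number of factors of `S` that are larger than `k`. -/
def Maya.above (k : ℤ) (S : Maya) : ℕ := (S.occ ∩ Set.Ioi k).ncard

section Fermions

variable (L : Type*) [Field L]

open Classical in
/-- `ψ_k`: wedge with `k` on the left, then reorder the factors into decreasing order. -/
def psi (k : ℤ) : (Maya →₀ L) →ₗ[L] (Maya →₀ L) :=
  Finsupp.linearCombination L fun S : Maya =>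
    if k ∈ S.occ then 0 else Finsupp.single (S.insert k) ((-1 : L) ^ S.above k)

open Classical in
/-- `ψ_k^*`, the adjoint of `ψ_k` for the inner product in which the basis is orthonormal
(see `psiStar_adjoint`). -/
def psiStar (k : ℤ) : (Maya →₀ L) →ₗ[L] (Maya →₀ L) :=
  Finsupp.linearCombination L fun S : Maya =>
    if k ∈ S.occ then Finsupp.single (S.erase k) ((-1 : L) ^ S.above k) else 0

theorem psiStar_adjoint (k : ℤ) (S T : Maya) :
    psiStar L k (Finsupp.single S 1) T = psi L k (Finsupp.single T 1) S := by
  classical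
  have key : (k ∈ S.occ ∧ S.erase k = T) ↔ (k ∉ T.occ ∧ T.insert k = S) := by
    constructor
    · rintro ⟨h, rfl⟩
      refine ⟨fun h' => h'.2 rfl, ?_⟩
      ext x
      simp only [Maya.insert, Maya.erase, Set.mem_insert_iff, Set.mem_sdiff, Set.mem_singleton_iff]
      by_cases hx : x = k
      · simp [hx, h]
      · simp [hx]
    · rintro ⟨h, rfl⟩
      refine ⟨Or.inl rfl, ?_⟩
      ext x
      simp only [Maya.insert, Maya.erase, Set.mem_insert_iff, Set.mem_sdiff, Set.mem_singleton_iff]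
      by_cases hx : x = k
      · simp [hx, h]
      · simp [hx]
  have habove : k ∉ T.occ → T.insert k = S → S.above k = T.above k := by
    rintro - rfl
    unfold Maya.above Maya.insert
    congr 1
    ext x
    simp only [Set.mem_inter_iff, Set.mem_insert_iff, Set.mem_Ioi]
    constructor
    · rintro ⟨rfl | h, h'⟩
      · exact absurd h' (lt_irrefl _)
      · exact ⟨h, h'⟩
    · rintro ⟨h, h'⟩
      exact ⟨Or.inr h, h'⟩
  unfold psi psiStar
  simp only [Finsupp.linearCombination_single, one_smul]
  by_cases h : k ∉ T.occ ∧ T.insert k = S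
  · have h2 := key.2 h
    rw [if_pos h2.1, if_neg h.1, h2.2, h.2, habove h.1 h.2]
    simp
  · have h2 := fun h' => h (key.1 h')
    have e1 : (if k ∈ S.occ then Finsupp.single (S.erase k) ((-1 : L) ^ S.above k) else 0) T = 0 := by
      split_ifs with hk
      · exact Finsupp.single_eq_of_ne' (fun h' => h2 ⟨hk, h'⟩)
      · rfl
    have e2 : (if k ∈ T.occ then 0 else Finsupp.single (T.insert k) ((-1 : L) ^ T.above k)) S = 0 := by
      split_ifs with hk
      · rfl
      · exact Finsupp.single_eq_of_ne' (fun h' => h ⟨hk, h'⟩)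
    rw [e1, e2]

/-- The normally ordered product `E_{i,j} = :ψ_i ψ_j^*:`. -/
def normalE (i j : ℤ) : (Maya →₀ L) →ₗ[L] (Maya →₀ L) :=
  if 0 ≤ j then psi L i ∘ₗ psiStar L j else -(psiStar L j ∘ₗ psi L i)

/-- The matrix of `E_{i,j}` in the basis: the entry at `(w, v)` is `(w, E_{i,j} v)`.
Infinite sums of operators are understood entry by entry; in all sums below
only finitely many terms contribute to a given entry. -/
def matE (i j : ℤ) : Matrix Maya Maya L :=
  Matrix.of fun w v => normalE L i j (Finsupp.single v 1) w

end Fermions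

section Operators

variable {K : Type*} [Field K] [CharZero K]

/-- `e^{c u}` as a Laurent series in the formal variable `u`. -/
def expU (c : K) : LaurentSeries K :=
  ((PowerSeries.rescale c (PowerSeries.exp K) : PowerSeries K) : LaurentSeries K)

/-- `ζ(c u) = e^{c u / 2} - e^{- c u / 2}`. -/
def zetaU (c : K) : LaurentSeries K := expU (c / 2) - expU (-(c / 2))

open Classical in
/-- `ℰ_n(z) = ∑_{k ∈ ℤ + 1/2} e^{z (k - n/2)} E_{k - n, k} + δ_{n,0} / ζ(z)` at `z = c u`. -/
def curlyE (n : ℤ) (c : K) : Matrix Maya Maya (LaurentSeries K) :=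
  Matrix.of fun w v =>
    (∑ᶠ k : ℤ, expU (c * ((k : K) + 1 / 2 - (n : K) / 2)) * matE (LaurentSeries K) (k - n) k w v)
      + if n = 0 then (zetaU c)⁻¹ * (1 : Matrix Maya Maya (LaurentSeries K)) w v else 0

/-- `b = P / Q`. -/
def bParam (K : Type*) [Field K] (P Q : ℤ) : K := (P : K) / (Q : K)

/-- `p_i^* = (A^i - A^{-i}) / ζ(i u / b)` with `A = t ^ Q`. -/
def pStar (P Q : ℤ) (t : K) (i : ℕ) : LaurentSeries K :=
  algebraMap K (LaurentSeries K) ((t ^ Q) ^ i - ((t ^ Q) ^ i)⁻¹)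
    / zetaU ((i : K) / bParam K P Q)

/-- The part `λ_{i+1}` of a partition (`i = 0, 1, …`), in weakly decreasing order, and `0` past
the end. -/
def part {k : ℕ} (lam : Nat.Partition k) (i : ℕ) : ℕ :=
  (lam.parts.sort (fun x y => x ≥ y)).getD i 0

/-- `∑_{λ ⊢ k} ∏_{i=1}^{ℓ(λ)} ((p_i^* / i) ζ(i u m))^{λ_i - λ_{i+1}} / (λ_i - λ_{i+1})!`. -/
def partitionSum (P Q : ℤ) (t : K) (m k : ℕ) : LaurentSeries K :=
  ∑ lam : Nat.Partition k, ∏ i ∈ Finset.range lam.parts.card,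
    (pStar P Q t (i + 1) / ((i + 1 : ℕ) : LaurentSeries K) * zetaU (((i + 1 : ℕ) : K) * (m : K)))
        ^ (part lam i - part lam (i + 1))
      / ((part lam i - part lam (i + 1)).factorial : LaurentSeries K)

/-- The operator `𝒜̃(m, u m) = (A^{b m} / m) ∑_{k ≥ 0} ℰ_{k-m}(u m) ∑_{λ ⊢ k} ⋯`,
where `A = t ^ Q` and `A ^ (b m) = t ^ (P m)`. -/
def Atilde (P Q : ℤ) (t : K) (m : ℕ) : Matrix Maya Maya (LaurentSeries K) :=
  Matrix.of fun w v =>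
    algebraMap K (LaurentSeries K) (t ^ (P * (m : ℤ)) / (m : K)) *
      ∑ᶠ k : ℕ, curlyE ((k : ℤ) - (m : ℤ)) (m : K) w v * partitionSum P Q t m k

open Classical in
/-- `c₀` and `c l s` are the coefficients of `𝒜̃(m, u m)`:
`𝒜̃(m, u m) = c₀ Id + ∑_{l ∈ ℤ + 1/2} ∑_{s ∈ ℤ} c_{l,s} E_{l-s,l}`. -/
def IsExpansion (P Q : ℤ) (t : K) (m : ℕ)
    (c₀ : LaurentSeries K) (c : ℤ → ℤ → LaurentSeries K) : Prop :=
  ∀ w v : Maya, Atilde P Q t m w v =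
    c₀ * (1 : Matrix Maya Maya (LaurentSeries K)) w v
      + ∑ᶠ p : ℤ × ℤ, c p.1 p.2 * matE (LaurentSeries K) (p.1 - p.2) p.1 w v

/-- The Jacobi polynomial `𝒫_n^{(α,β)}(z)`. For `n ≥ 0` this is
`Γ(α+n+1) / (Γ(α+1) n!) ₂F₁(-n, 1+α+β+n; α+1; (1-z)/2)`, with the quotient
`(α+1)_n / (α+1)_s = (α+s+1)_{n-s}` simplified (so that no value of `α` is exceptional) and
`(-n)_s / s! = (-1)^s (n choose s)`; for `n < 0` it is `0`, because of the factor `1/Γ(n+1)`. -/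
def jacobi (n : ℤ) (α β z : K) : K :=
  if n < 0 then 0 else
    (∑ s ∈ Finset.range (n.toNat + 1), (n.toNat.choose s : K)
        * (ascPochhammer K (n.toNat - s)).eval (α + (s : K) + 1)
        * (ascPochhammer K s).eval (1 + α + β + (n : K))
        * ((z - 1) / 2) ^ s)
      / (n.toNat.factorial : K)

/-- `ξ¹_m = (-1)^m A^{(b-1)m} 𝒫_{m-1}^{(m(b-1), 1)}(1 - 2A²)`. -/
def xi1 (P Q : ℤ) (t : K) (m : ℕ) : K :=
  (-1) ^ m * t ^ ((P - Q) * (m : ℤ)) *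
    jacobi ((m : ℤ) - 1) ((m : K) * (bParam K P Q - 1)) 1 (1 - 2 * (t ^ Q) ^ 2)

/-- `ξ²_m = (-1)^m A^{(b-1)m} 𝒫_{m-2}^{(m(b-1)+1, 1)}(1 - 2A²)`. -/
def xi2 (P Q : ℤ) (t : K) (m : ℕ) : K :=
  (-1) ^ m * t ^ ((P - Q) * (m : ℤ)) *
    jacobi ((m : ℤ) - 2) ((m : K) * (bParam K P Q - 1) + 1) 1 (1 - 2 * (t ^ Q) ^ 2)

/-- `f m = (F¹(m) ξ¹_m + F²(m) ξ²_m) / den m` for all integers `m ≥ m₀`, where `F¹`, `F²` are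
polynomials of degree at most `d`. -/
def IsXiCombination (P Q : ℤ) (t : K) (d m₀ : ℕ) (den f : ℕ → K) : Prop :=
  ∃ F₁ F₂ : K[X], F₁.natDegree ≤ d ∧ F₂.natDegree ≤ d ∧
    ∀ m : ℕ, m₀ ≤ m →
      f m = (F₁.eval (m : K) * xi1 P Q t m + F₂.eval (m : K) * xi2 P Q t m) / den m

end Operators

end AOp

end

/-!
Write `A = t ^ Q`, `a = m b`, `x = A²`, `n = m + s`.

An operator `c₀ Id + ∑ c_{l,s} E_{l-s,l}` determines its coefficients, because every `E_{i,j}` has a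
matrix entry at which all the others and, for `i ≠ j`, the identity vanish, while the vacuum
expectation value is `c₀` (`matE_expansion_unique`). So the coefficient of `E_{l-s,l}` can be read
off the definition: it is `(A^a / m) e^{um(l-s/2)}` times the sum over the partitions of `n`, and
the coefficient of `Id` is `(A^a / m) ζ(um)⁻¹` times the sum over the partitions of `m`.

Passing to the conjugate partition, the sums over partitions have the generating function `exp (∑
(A^i - A^{-i}) ζ(ium) / (i ζ(iu/b)) X^i)`. By the `q`-binomial theorem with `q = e^{u/b}` it factors
into two series whose coefficients are the products `∏_{t<j} ζ((±a+t)u/b) / ζ((t+1)u/b)`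
(`partitionSum_eq_sum`). Each product is `(±a)_j / j!` times a power series in `u` whose
`u^k`-coefficient is a polynomial in `a` and `j` of total degree at most `2k`, since its difference
in `j` is a polynomial built from lower coefficients (`coeff_zetaCorrection_mem`).

Hence, up to a power of `A`, every `u^k`-coefficient is `p(m, θ) g` for a polynomial `p` and `θ = x
d/dx`, where `g` is the coefficient of `X^n` in `(1 - X)^a (1 - xX)^{-a}`. The polynomial `g`
satisfies a hypergeometric equation of order two with singularities at `x = 0, 1, ∞`, which removes
the powers of `θ` beyond the first if `x ≠ 1`. As `n g` and `θ g` are `a` times combinations of two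
consecutive coefficients of `(1 - X)^{a-1} (1 - xX)^{-a-1}`, no denominators in `a - i` arise, and
the prefactor `1 / m` is cancelled (`polyComb_natCast_mul_hyperSum`). Those coefficients are Jacobi
polynomials; for `n = m` they are `ξ¹_m` and `ξ²_m` up to sign and a common factor, and their
three-term recurrence in `n` introduces no denominators besides the factors of `(m+1)⋯(m+s)` and of
`(m-1)⋯(m+s+1)(m+s)²` (`polyComb_jacobiCoeff_up`, `polyComb_jacobiCoeff_down`). If `x = 1`, all
`p_i^*` vanish and so do the coefficients in question.
-/

noncomputable section

open scoped PowerSeries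

namespace AOp

/-! ### The expansion in the operators `E_{i,j}` -/

section Operators

theorem psi_single (L : Type*) [Field L] (i : ℤ) (v : Maya) (r : L) [Decidable (i ∈ v.occ)] :
    psi L i (Finsupp.single v r) =
      if i ∈ v.occ then 0 else Finsupp.single (v.insert i) (r * (-1) ^ v.above i) := by
  unfold psi
  rw [Finsupp.linearCombination_single]
  split_ifs <;> simp

theorem psiStar_single (L : Type*) [Field L] (j : ℤ) (v : Maya) (r : L) [Decidable (j ∈ v.occ)] :
    psiStar L j (Finsupp.single v r) =
      if j ∈ v.occ then Finsupp.single (v.erase j) (r * (-1) ^ v.above j) else 0 := by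
  unfold psiStar
  rw [Finsupp.linearCombination_single]
  split_ifs <;> simp

/-- The positions of the non-zero entries of `E_{i,j}`: it moves a factor from `j` to `i ≠ j`,
and `E_{j,j}` is diagonal, counting `j` among the particles or the holes. -/
theorem matE_ne_zero_iff (L : Type*) [Field L] (i j : ℤ) (w v : Maya) :
    matE L i j w v ≠ 0 ↔
      (i = j ∧ w = v ∧ ((0 ≤ j ∧ j ∈ v.occ) ∨ (j < 0 ∧ j ∉ v.occ))) ∨
      (i ≠ j ∧ j ∈ v.occ ∧ i ∉ v.occ ∧ w.occ = insert i (v.occ \ {j})) := by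
  classical
  have hs : ∀ n : ℕ, ((-1 : L)) ^ n ≠ 0 := fun n => pow_ne_zero _ (by simp)
  have key : ∀ (x w : Maya) (r : L), r ≠ 0 → ((Finsupp.single x r) w ≠ 0 ↔ w.occ = x.occ) := by
    intro x w r hr
    rw [Finsupp.single_apply]
    constructor
    · intro h
      by_contra h'
      exact h (if_neg fun h'' => h' (by rw [h'']))
    · intro h
      rw [if_pos (Maya.ext h).symm]
      exact hr
  simp only [matE, Matrix.of_apply]
  unfold normalE
  by_cases hj : 0 ≤ j
  · rw [if_pos hj, LinearMap.comp_apply, psiStar_single]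
    by_cases hv : j ∈ v.occ
    · rw [if_pos hv, psi_single]
      by_cases hi : i ∈ (v.erase j).occ
      · rw [if_pos hi]
        have hi' : i ∈ v.occ ∧ i ≠ j := hi
        simp [hi'.1, hi'.2]
      · rw [if_neg hi, key _ _ _ (mul_ne_zero (mul_ne_zero one_ne_zero (hs _)) (hs _))]
        have hi' : ¬ (i ∈ v.occ ∧ i ≠ j) := hi
        have e : ((v.erase j).insert i).occ = insert i (v.occ \ {j}) := rfl
        rw [e]
        by_cases hij : i = j
        · subst hij
          rw [Set.insert_sdiff_singleton, Set.insert_eq_of_mem hv]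
          simp [hv, hj, Maya.ext_iff]
        · have : i ∉ v.occ := fun h => hi' ⟨h, hij⟩
          simp [hij, hv, this]
    · simp [hv, hj]
  · rw [if_neg hj, LinearMap.neg_apply, LinearMap.comp_apply, psi_single]
    have hj' : j < 0 := not_le.1 hj
    by_cases hv : i ∈ v.occ
    · rw [if_pos hv]
      simp only [map_zero, neg_zero, Finsupp.coe_zero, Pi.zero_apply, ne_eq, not_true_eq_false,
        false_iff]
      rintro (⟨rfl, -, h⟩ | h)
      · rcases h with h | h
        · exact hj h.1
        · exact h.2 hv
      · exact h.2.2.1 hv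
    · rw [if_neg hv, psiStar_single]
      by_cases hi : j ∈ (v.insert i).occ
      · rw [if_pos hi, Finsupp.neg_apply, neg_ne_zero,
          key _ _ _ (mul_ne_zero (mul_ne_zero one_ne_zero (hs _)) (hs _))]
        have hi' : j = i ∨ j ∈ v.occ := hi
        have e : ((v.insert i).erase j).occ = insert i v.occ \ {j} := rfl
        rw [e]
        by_cases hij : i = j
        · subst hij
          have : insert i v.occ \ {i} = v.occ := by
            ext y
            simp only [Set.mem_sdiff, Set.mem_insert_iff, Set.mem_singleton_iff]
            constructor
            · tauto
            · intro h
              exact ⟨Or.inr h, fun h' => hv (h' ▸ h)⟩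
          rw [this]
          simp [hv, hj', Maya.ext_iff]
        · have h1 : j ∈ v.occ := hi'.resolve_left (Ne.symm hij)
          rw [Set.insert_sdiff_of_notMem _ (by simpa using hij)]
          simp [hij, hv, h1]
      · rw [if_neg hi]
        have hi' : ¬ (j = i ∨ j ∈ v.occ) := hi
        push Not at hi'
        simp [hi'.2, Ne.symm hi'.1]

theorem matE_self_eq_zero (L : Type*) [Field L] {i j : ℤ} (h : i ≠ j) (v : Maya) :
    matE L i j v v = 0 := by
  by_contra h0
  rcases (matE_ne_zero_iff L i j v v).1 h0 with h1 | ⟨-, h1, h2, h3⟩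
  · exact h h1.1
  · exact h2 (h3 ▸ Set.mem_insert _ _)

/-- An off-diagonal entry is non-zero for at most one `E_{i,j}`. -/
theorem matE_unique (L : Type*) [Field L] {i j i' j' : ℤ} {w v : Maya} (hw : w ≠ v)
    (h : matE L i j w v ≠ 0) (h' : matE L i' j' w v ≠ 0) : i' = i ∧ j' = j := by
  rcases (matE_ne_zero_iff L i j w v).1 h with h | ⟨h1, h2, h3, h4⟩
  · exact absurd h.2.1 hw
  rcases (matE_ne_zero_iff L i' j' w v).1 h' with h | ⟨h1', h2', h3', h4'⟩
  · exact absurd h.2.1 hw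
  constructor
  · have : i' ∈ w.occ := h4' ▸ Set.mem_insert _ _
    rw [h4] at this
    exact this.resolve_right fun h => h3' h.1
  · have : j' ∉ w.occ := by
      rw [h4']
      rintro (h | h)
      · exact h1' h.symm
      · exact h.2 rfl
    rw [h4] at this
    by_contra hne
    exact this (Or.inr ⟨h2', hne⟩)

theorem finite_matE_diag (L : Type*) [Field L] (v : Maya) :
    {j : ℤ | matE L j j v v ≠ 0}.Finite := by
  refine (v.finite_pos.union v.finite_neg).subset ?_
  intro j hj
  rcases (matE_ne_zero_iff L j j v v).1 hj with ⟨-, -, h | h⟩ | h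
  · exact Or.inl ⟨h.2, h.1⟩
  · exact Or.inr ⟨h.1, h.2⟩
  · exact absurd rfl h.1

/-- The vacuum `\underline{-1/2} ∧ \underline{-3/2} ∧ ⋯`. -/
def vacuum : Maya where
  occ := Set.Iio 0
  finite_pos := by
    convert Set.finite_empty (α := ℤ)
    ext x
    simp
  finite_neg := by simp

theorem matE_vacuum (L : Type*) [Field L] (i j : ℤ) : matE L i j vacuum vacuum = 0 := by
  by_contra h
  rcases (matE_ne_zero_iff L i j _ _).1 h with ⟨-, -, h | h⟩ | ⟨h0, h1, h2, h3⟩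
  · exact absurd h.2 (not_lt.2 h.1)
  · exact h.2 h.1
  · exact h2 (h3 ▸ Set.mem_insert _ _)

/-- Every `E_{j,j}` is detected by a diagonal entry at which all other `E_{i,i}` vanish. -/
theorem exists_matE_diag_ne_zero (L : Type*) [Field L] (j : ℤ) :
    ∃ v : Maya, matE L j j v v ≠ 0 ∧ ∀ i, i ≠ j → matE L i i v v = 0 := by
  by_cases hj : 0 ≤ j
  · refine ⟨vacuum.insert j, (matE_ne_zero_iff ..).2 (Or.inl ⟨rfl, rfl, Or.inl ⟨hj, Or.inl rfl⟩⟩),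
      fun i hi => ?_⟩
    by_contra h
    rcases (matE_ne_zero_iff L i i _ _).1 h with ⟨-, -, h | h⟩ | h
    · rcases h.2 with h' | h'
      · exact hi h'
      · exact absurd h.1 (not_le.2 h')
    · exact h.2 (Or.inr h.1)
    · exact h.1 rfl
  · refine ⟨vacuum.erase j, (matE_ne_zero_iff ..).2 (Or.inl ⟨rfl, rfl, Or.inr ⟨not_le.1 hj,
      fun h => h.2 rfl⟩⟩), fun i hi => ?_⟩
    by_contra h
    rcases (matE_ne_zero_iff L i i _ _).1 h with ⟨-, -, h | h⟩ | h
    · exact absurd h.1 (not_le.2 h.2.1)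
    · exact h.2 ⟨h.1, hi⟩
    · exact h.1 rfl

/-- Every `E_{i,j}` with `i ≠ j` has a non-zero entry, necessarily off the diagonal. -/
theorem exists_matE_ne_zero (L : Type*) [Field L] {i j : ℤ} (hij : i ≠ j) :
    ∃ w v : Maya, w ≠ v ∧ matE L i j w v ≠ 0 := by
  let v : Maya := (vacuum.insert j).erase i
  have hj : j ∈ v.occ := ⟨Or.inl rfl, fun h => hij h.symm⟩
  have hi : i ∉ v.occ := fun h => h.2 rfl
  refine ⟨(v.erase j).insert i, v, fun h => hi ?_,
    (matE_ne_zero_iff ..).2 (Or.inr ⟨hij, hj, hi, rfl⟩)⟩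
  rw [← h]
  exact Or.inl rfl

/-- A diagonal entry of `∑ c_{l,s} E_{l-s,l}`. -/
theorem finsum_matE_diag {L : Type*} [Field L] (c : ℤ → ℤ → L) (v : Maya) :
    ∑ᶠ p : ℤ × ℤ, c p.1 p.2 * matE L (p.1 - p.2) p.1 v v = ∑ᶠ l : ℤ, c l 0 * matE L l l v v := by
  classical
  have hinj : Function.Injective fun l : ℤ => ((l, 0) : ℤ × ℤ) := fun a b h => (Prod.ext_iff.1 h).1
  rw [← finsum_mem_univ (f := fun l : ℤ => c l 0 * matE L l l v v)]
  have h := finsum_mem_image (s := Set.univ) (f := fun p : ℤ × ℤ =>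
    c p.1 p.2 * matE L (p.1 - p.2) p.1 v v) hinj.injOn
  simp only [sub_zero] at h
  rw [← h, finsum_mem_def]
  refine finsum_congr fun p => ?_
  rw [Set.indicator_apply]
  split_ifs with hp
  · rfl
  · rw [matE_self_eq_zero, mul_zero]
    intro h'
    refine hp ⟨p.1, trivial, ?_⟩
    ext
    · rfl
    · simp only
      omega

/-- An off-diagonal entry of `∑ c_{l,s} E_{l-s,l}`. -/
theorem finsum_matE_of_ne_zero {L : Type*} [Field L] (c : ℤ → ℤ → L) {w v : Maya} (hw : w ≠ v)
    {l s : ℤ} (h : matE L (l - s) l w v ≠ 0) :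
    ∑ᶠ p : ℤ × ℤ, c p.1 p.2 * matE L (p.1 - p.2) p.1 w v = c l s * matE L (l - s) l w v := by
  refine finsum_eq_single _ (l, s) fun p hp => ?_
  by_contra h'
  obtain ⟨h1, h2⟩ := matE_unique L hw h (right_ne_zero_of_mul h')
  refine hp (Prod.ext h2 ?_)
  simp only
  omega

open Classical in
/-- An operator `c₀ Id + ∑ c_{l,s} E_{l-s,l}` determines its coefficients. -/
theorem matE_expansion_unique {L : Type*} [Field L] {c₀ d₀ : L} {c d : ℤ → ℤ → L}
    (h : ∀ w v : Maya,
      c₀ * (1 : Matrix Maya Maya L) w v + ∑ᶠ p : ℤ × ℤ, c p.1 p.2 * matE L (p.1 - p.2) p.1 w v =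
      d₀ * (1 : Matrix Maya Maya L) w v + ∑ᶠ p : ℤ × ℤ, d p.1 p.2 * matE L (p.1 - p.2) p.1 w v) :
    c₀ = d₀ ∧ c = d := by
  have h0 : c₀ = d₀ := by
    have := h vacuum vacuum
    simpa [matE_vacuum] using this
  subst h0
  refine ⟨rfl, ?_⟩
  have h' : ∀ w v : Maya, ∑ᶠ p : ℤ × ℤ, c p.1 p.2 * matE L (p.1 - p.2) p.1 w v =
      ∑ᶠ p : ℤ × ℤ, d p.1 p.2 * matE L (p.1 - p.2) p.1 w v := fun w v => add_left_cancel (h w v)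
  ext l s
  by_cases hs : s = 0
  · subst hs
    obtain ⟨v, hv, hv'⟩ := exists_matE_diag_ne_zero L l
    have := h' v v
    rw [finsum_matE_diag, finsum_matE_diag, finsum_eq_single _ l, finsum_eq_single _ l] at this
    · exact mul_right_cancel₀ hv this
    all_goals
      intro i hi
      rw [hv' i hi, mul_zero]
  · obtain ⟨w, v, hw, hv⟩ := exists_matE_ne_zero L (i := l - s) (j := l) (by omega)
    have := h' w v
    rw [finsum_matE_of_ne_zero _ hw hv, finsum_matE_of_ne_zero _ hw hv] at this
    exact mul_right_cancel₀ hv this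

variable {K : Type*} [Field K] [CharZero K]

open Classical in
theorem curlyE_apply_of_ne_zero {w v : Maya} (hw : w ≠ v) {l s : ℤ}
    (h : matE (LaurentSeries K) (l - s) l w v ≠ 0) (n : ℤ) (c : K) :
    curlyE n c w v = if n = s then
      expU (c * ((l : K) + 1 / 2 - (s : K) / 2)) * matE (LaurentSeries K) (l - s) l w v else 0 := by
  have hone : (1 : Matrix Maya Maya (LaurentSeries K)) w v = 0 := Matrix.one_apply_ne hw
  simp only [curlyE, Matrix.of_apply, hone, mul_zero, ite_self, add_zero]
  split_ifs with hn
  · subst hn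
    refine finsum_eq_single _ l fun k hk => ?_
    by_contra h'
    exact hk (matE_unique _ hw h (right_ne_zero_of_mul h')).2
  · rw [← finsum_zero (α := ℤ)]
    refine finsum_congr fun k => ?_
    by_contra h'
    have := matE_unique _ hw h (right_ne_zero_of_mul h')
    omega

open Classical in
theorem curlyE_diag (n : ℤ) (c : K) (v : Maya) :
    curlyE n c v v = if n = 0 then
      (∑ᶠ l : ℤ, expU (c * ((l : K) + 1 / 2)) * matE (LaurentSeries K) l l v v) + (zetaU c)⁻¹
      else 0 := by
  simp only [curlyE, Matrix.of_apply, Matrix.one_apply_eq, mul_one]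
  split_ifs with hn
  · subst hn
    simp
  · rw [add_zero, ← finsum_zero (α := ℤ)]
    refine finsum_congr fun k => ?_
    rw [matE_self_eq_zero _ (by omega), mul_zero]

/-- The coefficient of `E_{l-s,l}` in `𝒜̃(m, u m)`: only the summand `k = m + s` contributes, and
none if `m + s < 0`. -/
def coeffE (P Q : ℤ) (t : K) (m : ℕ) (l s : ℤ) : LaurentSeries K :=
  if 0 ≤ (m : ℤ) + s then
    algebraMap K (LaurentSeries K) (t ^ (P * (m : ℤ)) / (m : K)) *
      (expU ((m : K) * ((l : K) + 1 / 2 - (s : K) / 2)) * partitionSum P Q t m ((m : ℤ) + s).toNat)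
  else 0

/-- The coefficient of `Id` in `𝒜̃(m, u m)`. -/
def coeffId (P Q : ℤ) (t : K) (m : ℕ) : LaurentSeries K :=
  algebraMap K (LaurentSeries K) (t ^ (P * (m : ℤ)) / (m : K)) *
    ((zetaU (m : K))⁻¹ * partitionSum P Q t m m)

theorem isExpansion_coeff (P Q : ℤ) (t : K) (m : ℕ) :
    IsExpansion P Q t m (coeffId P Q t m) (coeffE P Q t m) := by
  classical
  intro w v
  simp only [Atilde, Matrix.of_apply]
  by_cases hw : w = v
  · subst hw
    rw [Matrix.one_apply_eq, mul_one, finsum_matE_diag, finsum_eq_single _ m]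
    · rw [curlyE_diag, if_pos (sub_self _), add_mul, mul_add, add_comm, coeffId, finsum_mul',
        mul_finsum']
      · congr 1
        refine finsum_congr fun l => ?_
        simp only [coeffE, add_zero, Int.natCast_nonneg, if_true, Int.cast_zero, zero_div, sub_zero,
          Int.toNat_natCast]
        ring
      · refine (finite_matE_diag (LaurentSeries K) w).subset fun l hl h => hl ?_
        simp only [h, mul_zero, zero_mul]
      · refine (finite_matE_diag (LaurentSeries K) w).subset fun l hl h => hl ?_
        simp only [h, mul_zero]
    · intro k hk
      rw [curlyE_diag, if_neg (by omega), zero_mul]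
  · rw [Matrix.one_apply_ne hw, mul_zero, zero_add]
    by_cases h : ∃ i j, matE (LaurentSeries K) i j w v ≠ 0
    · obtain ⟨i, j, h⟩ := h
      obtain ⟨s, rfl⟩ : ∃ s, i = j - s := ⟨j - i, by ring⟩
      rw [finsum_matE_of_ne_zero _ hw h]
      simp only [curlyE_apply_of_ne_zero hw h]
      unfold coeffE
      split_ifs with hs
      · rw [finsum_eq_single _ ((m : ℤ) + s).toNat]
        · rw [if_pos (by omega)]
          ring
        · intro k hk
          rw [if_neg (by omega), zero_mul]
      · rw [zero_mul, finsum_eq_zero_of_forall_eq_zero, mul_zero]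
        intro k
        rw [if_neg (by omega), zero_mul]
    · push Not at h
      have hone : (1 : Matrix Maya Maya (LaurentSeries K)) w v = 0 := Matrix.one_apply_ne hw
      simp [h, curlyE, hone]

theorem isExpansion_iff (P Q : ℤ) (t : K) (m : ℕ) (c₀ : LaurentSeries K)
    (c : ℤ → ℤ → LaurentSeries K) :
    IsExpansion P Q t m c₀ c ↔ c₀ = coeffId P Q t m ∧ c = coeffE P Q t m := by
  constructor
  · intro h
    exact matE_expansion_unique fun w v =>
      (h w v).symm.trans (isExpansion_coeff P Q t m w v)
  · rintro ⟨rfl, rfl⟩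
    exact isExpansion_coeff P Q t m

end Operators

/-! ### Sums over partitions as an exponential -/

section Partitions

variable {n : ℕ} (lam : Nat.Partition n)

theorem part_eq_zero_iff (i : ℕ) : part lam i = 0 ↔ lam.parts.card ≤ i := by
  set l := lam.parts.sort (fun x y => x ≥ y) with hl
  have hlen : l.length = lam.parts.card := Multiset.length_sort ..
  have hdef : part lam i = l.getD i 0 := rfl
  rw [hdef, ← hlen]
  by_cases h : i < l.length
  · rw [List.getD_eq_getElem _ _ h]
    have hm : l[i] ∈ lam.parts := by
      rw [← Multiset.mem_sort (r := fun x y => x ≥ y)]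
      exact List.getElem_mem h
    have := lam.parts_pos hm
    omega
  · rw [List.getD_eq_default _ _ (not_lt.1 h)]
    simp [not_lt.1 h]

theorem part_antitone : Antitone (part lam) := by
  set l := lam.parts.sort (fun x y => x ≥ y) with hl
  have hdef : ∀ i, part lam i = l.getD i 0 := fun _ => rfl
  have hp : l.Pairwise (fun x y => x ≥ y) := Multiset.pairwise_sort ..
  intro i j hij
  rw [hdef, hdef]
  by_cases h : j < l.length
  · rcases hij.eq_or_lt with rfl | hlt
    · exact le_rfl
    · rw [List.getD_eq_getElem _ _ h, List.getD_eq_getElem _ _ (hij.trans_lt h)]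
      exact List.pairwise_iff_getElem.1 hp i j _ h hlt
  · rw [List.getD_eq_default _ _ (not_lt.1 h)]
    exact Nat.zero_le _

theorem sum_getD (l : List ℕ) : ∑ i ∈ Finset.range l.length, l.getD i 0 = l.sum := by
  induction l with
  | nil => simp
  | cons a l ih =>
    rw [List.length_cons, Finset.sum_range_succ']
    simp only [List.getD_cons_succ, List.getD_cons_zero, List.sum_cons, ih, add_comm]

theorem card_parts_le : lam.parts.card ≤ n := by
  have h := Multiset.card_nsmul_le_sum (s := lam.parts) (a := 1) fun x hx => lam.parts_pos hx
  rw [lam.parts_sum] at h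
  simpa using h

theorem sum_part {N : ℕ} (hN : lam.parts.card ≤ N) : ∑ i ∈ Finset.range N, part lam i = n := by
  have h1 : ∑ i ∈ Finset.range lam.parts.card, part lam i = n := by
    have := sum_getD (lam.parts.sort (fun x y => x ≥ y))
    rw [Multiset.length_sort, ← Multiset.sum_coe, Multiset.sort_eq, lam.parts_sum] at this
    exact this
  refine (Finset.sum_subset (Finset.range_mono hN) fun i _ hi => ?_).symm.trans h1
  rw [part_eq_zero_iff]
  simpa using hi

/-- Summation by parts for the differences of a weakly decreasing sequence. -/
theorem sum_succ_mul_sub {p : ℕ → ℕ} (hp : Antitone p) (N : ℕ) :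
    ∑ i ∈ Finset.range N, (i + 1) * (p i - p (i + 1)) + N * p N = ∑ i ∈ Finset.range N, p i := by
  induction N with
  | zero => simp
  | succ N ih =>
    rw [Finset.sum_range_succ, Finset.sum_range_succ, ← ih]
    obtain ⟨d, hd⟩ := Nat.exists_eq_add_of_le (hp (Nat.le_succ N))
    rw [hd, Nat.add_sub_cancel_left]
    ring

theorem partition_ext {lam mu : Nat.Partition n} (h : ∀ i, part lam i = part mu i) : lam = mu := by
  have hcard : lam.parts.card = mu.parts.card := by
    refine le_antisymm ?_ ?_
    · rw [← part_eq_zero_iff, h, part_eq_zero_iff]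
    · rw [← part_eq_zero_iff, ← h, part_eq_zero_iff]
  have hsort : lam.parts.sort (fun x y => x ≥ y) = mu.parts.sort (fun x y => x ≥ y) := by
    refine List.ext_getElem (by simpa using hcard) fun i h1 h2 => ?_
    rw [← List.getD_eq_getElem _ 0 h1, ← List.getD_eq_getElem _ 0 h2]
    exact h i
  ext1
  rw [← Multiset.sort_eq lam.parts (fun x y => x ≥ y), hsort, Multiset.sort_eq]

/-- The finitely supported function `i ↦ (i + 1) (λ_{i+1} - λ_{i+2})`; the quotients
`λ_{i+1} - λ_{i+2}` are the multiplicities of the parts of the conjugate partition. -/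
def conjWeights : ℕ →₀ ℕ :=
  Finsupp.onFinset (Finset.range n) (fun i => (i + 1) * (part lam i - part lam (i + 1))) <| by
    intro i hi
    rw [Finset.mem_range]
    by_contra h
    refine hi ?_
    rw [(part_eq_zero_iff lam i).2 ((card_parts_le lam).trans (not_lt.1 h))]
    simp

theorem conjWeights_apply (i : ℕ) :
    conjWeights lam i = (i + 1) * (part lam i - part lam (i + 1)) := rfl

theorem conjWeights_injective : Function.Injective (conjWeights (n := n)) := by
  intro lam mu h
  have hd : ∀ i, part lam i - part lam (i + 1) = part mu i - part mu (i + 1) := fun i =>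
    Nat.eq_of_mul_eq_mul_left (Nat.succ_pos i) (DFunLike.congr_fun h i)
  have hz : ∀ (nu : Nat.Partition n) i, n ≤ i → part nu i = 0 := fun nu i hi =>
    (part_eq_zero_iff nu i).2 ((card_parts_le nu).trans hi)
  refine partition_ext fun i => ?_
  by_cases hi : n ≤ i
  · rw [hz _ _ hi, hz _ _ hi]
  · refine Nat.decreasingInduction (motive := fun k _ => part lam k = part mu k)
      (fun k _ ih => ?_) ?_ (not_le.1 hi).le
    · have h1 := part_antitone lam (Nat.le_succ k)
      have h2 := part_antitone mu (Nat.le_succ k)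
      have := hd k
      simp only [Nat.succ_eq_add_one] at h1 h2
      omega
    · rw [hz _ _ le_rfl, hz _ _ le_rfl]

theorem conjWeights_mem :
    conjWeights lam ∈ Finset.finsuppAntidiag (Finset.range n) n := by
  rw [Finset.mem_finsuppAntidiag]
  refine ⟨?_, Finsupp.support_onFinset_subset⟩
  have h := sum_succ_mul_sub (part_antitone lam) n
  rw [(part_eq_zero_iff lam n).2 (card_parts_le lam), sum_part lam (card_parts_le lam), mul_zero,
    add_zero] at h
  exact h

/-- A weakly decreasing sequence with sum `n` is the sequence of parts of a partition of `n`. -/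
theorem exists_part_eq {p : ℕ → ℕ} (hp : Antitone p) {N : ℕ} (hN : p N = 0)
    (hsum : ∑ i ∈ Finset.range N, p i = n) : ∃ lam : Nat.Partition n, ∀ i, part lam i = p i := by
  classical
  have hex : ∃ N, p N = 0 := ⟨N, hN⟩
  set N₀ := Nat.find hex with hN₀
  have hz : ∀ i, N₀ ≤ i → p i = 0 := fun i hi =>
    Nat.le_zero.1 ((hp hi).trans (Nat.find_spec hex).le)
  have hlt : ∀ i, i < N₀ → 0 < p i := fun i hi => Nat.pos_of_ne_zero (Nat.find_min hex hi)
  have hle : N₀ ≤ N := Nat.find_min' hex hN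
  let l : List ℕ := (List.range N₀).map p
  have hl : l.sum = n := by
    have e : l.sum = ∑ i ∈ Finset.range N₀, p i := rfl
    rw [e, ← hsum]
    refine Finset.sum_subset (Finset.range_mono hle) fun i _ hi => hz i ?_
    simpa using hi
  have hpair : l.Pairwise (fun x y => x ≥ y) := by
    rw [List.pairwise_iff_getElem]
    intro i j hi hj hij
    simp only [l, List.getElem_map, List.getElem_range]
    exact hp hij.le
  refine ⟨⟨l, fun {i} hi => ?_, by simpa using hl⟩, fun i => ?_⟩
  · rw [Multiset.mem_coe, List.mem_map] at hi
    obtain ⟨k, hk, rfl⟩ := hi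
    exact hlt k (List.mem_range.1 hk)
  · unfold part
    simp only [Multiset.coe_sort]
    rw [List.mergeSort_eq_self _ hpair]
    by_cases hi : i < N₀
    · rw [List.getD_eq_getElem _ _ (by simpa [l] using hi)]
      simp [l]
    · rw [List.getD_eq_default _ _ (by simpa [l] using hi), hz i (not_lt.1 hi)]

/-- The exponent vectors `(i + 1) c_i` with `∑ (i + 1) c_i = n` all come from partitions. -/
theorem exists_conjWeights_eq {f : ℕ →₀ ℕ} (hf : f ∈ Finset.finsuppAntidiag (Finset.range n) n)
    (hdvd : ∀ i ∈ Finset.range n, i + 1 ∣ f i) : ∃ lam : Nat.Partition n, conjWeights lam = f := by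
  rw [Finset.mem_finsuppAntidiag] at hf
  let p : ℕ → ℕ := fun i => ∑ j ∈ Finset.Ico i n, f j / (j + 1)
  have hp : Antitone p := fun i j hij => Finset.sum_le_sum_of_subset (Finset.Ico_subset_Ico_left hij)
  have hpn : ∀ i, n ≤ i → p i = 0 := fun i hi => by simp [p, Finset.Ico_eq_empty_of_le hi]
  have hd : ∀ i, (i + 1) * (p i - p (i + 1)) = f i := by
    intro i
    by_cases hi : i < n
    · have : p i = f i / (i + 1) + p (i + 1) := Finset.sum_eq_sum_Ico_succ_bot hi _
      rw [this, Nat.add_sub_cancel, Nat.mul_div_cancel' (hdvd i (Finset.mem_range.2 hi))]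
    · rw [hpn i (not_lt.1 hi), Nat.zero_sub, mul_zero]
      by_contra h
      exact hi (Finset.mem_range.1 (hf.2 (Finsupp.mem_support_iff.2 (Ne.symm h))))
  have hsum : ∑ i ∈ Finset.range n, p i = n := by
    rw [← sum_succ_mul_sub hp n, hpn n le_rfl, mul_zero, add_zero]
    simp only [hd]
    exact hf.1
  obtain ⟨lam, hlam⟩ := exists_part_eq hp (hpn n le_rfl) hsum
  refine ⟨lam, ?_⟩
  ext i
  rw [conjWeights_apply, hlam, hlam, hd]

end Partitions

section ExponentialFormula

open PowerSeries

variable {L : Type*} [Field L]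

/-- The power series `exp (w X^{i+1})`. -/
def expMonomial (w : L) (i : ℕ) : L⟦X⟧ :=
  PowerSeries.mk fun k => if i + 1 ∣ k then w ^ (k / (i + 1)) / ((k / (i + 1)).factorial : L) else 0

/-- The sum over partitions is a coefficient of `exp (∑ w_i X^{i+1})`. -/
theorem sum_partition_eq_coeff (w : ℕ → L) (n : ℕ) :
    ∑ lam : Nat.Partition n, ∏ i ∈ Finset.range lam.parts.card,
      w i ^ (part lam i - part lam (i + 1)) / ((part lam i - part lam (i + 1)).factorial : L) =
    PowerSeries.coeff n (∏ i ∈ Finset.range n, expMonomial (w i) i) := by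
  rw [PowerSeries.coeff_prod]
  refine Finset.sum_of_injOn conjWeights conjWeights_injective.injOn
    (fun lam _ => conjWeights_mem lam) (fun f hf hnot => ?_) fun lam _ => ?_
  · by_contra hne
    refine hnot ?_
    obtain ⟨lam, rfl⟩ := exists_conjWeights_eq hf fun i hi => by
      by_contra hd
      refine hne (Finset.prod_eq_zero hi ?_)
      rw [expMonomial, PowerSeries.coeff_mk, if_neg hd]
    exact ⟨lam, Finset.mem_coe.2 (Finset.mem_univ _), rfl⟩
  · have hc : ∀ i, PowerSeries.coeff (conjWeights lam i) (expMonomial (w i) i) =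
        w i ^ (part lam i - part lam (i + 1)) / ((part lam i - part lam (i + 1)).factorial : L) := by
      intro i
      rw [expMonomial, PowerSeries.coeff_mk, conjWeights_apply, if_pos (dvd_mul_right _ _),
        Nat.mul_div_cancel_left _ (Nat.succ_pos i)]
    rw [Finset.prod_congr rfl fun i _ => hc i]
    refine Finset.prod_subset (Finset.range_mono (card_parts_le lam)) fun i _ hi => ?_
    have h0 : part lam i = 0 := (part_eq_zero_iff lam i).2 (by simpa using hi)
    simp [h0]

theorem X_mul_derivative_expMonomial [CharZero L] (w : L) (i : ℕ) :
    PowerSeries.X * d⁄dX L (expMonomial w i) = PowerSeries.C ((i + 1 : ℕ) * w) * PowerSeries.X ^ (i + 1) * expMonomial w i := by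
  ext k
  rw [mul_assoc, PowerSeries.coeff_C_mul, PowerSeries.coeff_X_pow_mul']
  rcases k with _ | k
  · simp
  rw [PowerSeries.coeff_succ_X_mul, PowerSeries.coeff_derivative]
  simp only [expMonomial, PowerSeries.coeff_mk]
  by_cases hk : i + 1 ∣ k + 1
  · obtain ⟨q, hq⟩ := hk
    obtain ⟨q, rfl⟩ : ∃ q', q = q' + 1 := Nat.exists_eq_succ_of_ne_zero (by rintro rfl; simp at hq)
    have hle : i + 1 ≤ k + 1 := by rw [hq]; exact Nat.le_mul_of_pos_right _ (Nat.succ_pos _)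
    have hsub : k + 1 - (i + 1) = (i + 1) * q := by rw [hq, mul_add, mul_one, Nat.add_sub_cancel]
    have hcast : ((k : L) + 1) = (i + 1) * (q + 1) := by exact_mod_cast hq
    rw [if_pos hle, hsub, hq, if_pos (dvd_mul_right _ _), if_pos (dvd_mul_right _ _),
      Nat.mul_div_cancel_left _ (Nat.succ_pos i), Nat.mul_div_cancel_left _ (Nat.succ_pos i),
      hcast, Nat.factorial_succ]
    have h1 : (q.factorial : L) ≠ 0 := Nat.cast_ne_zero.2 (Nat.factorial_ne_zero q)
    have h2 : (q : L) + 1 ≠ 0 := Nat.cast_add_one_ne_zero q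
    push_cast
    field_simp
    ring
  · rw [if_neg hk, zero_mul]
    split_ifs with h1 h2
    · have h3 := Nat.dvd_add h2 (dvd_refl (i + 1))
      rw [Nat.sub_add_cancel h1] at h3
      exact absurd h3 hk
    · simp
    · simp

/-- The derivation `X d/dX` applied to a finite product of solutions of `X F' = R F`. -/
theorem X_mul_derivative_prod {ι : Type*} (s : Finset ι) (F R : ι → L⟦X⟧)
    (h : ∀ i ∈ s, PowerSeries.X * d⁄dX L (F i) = R i * F i) :
    PowerSeries.X * d⁄dX L (∏ i ∈ s, F i) = (∑ i ∈ s, R i) * ∏ i ∈ s, F i := by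
  classical
  induction s using Finset.induction_on with
  | empty => simp
  | insert a s ha ih =>
    rw [Finset.prod_insert ha, Finset.sum_insert ha, Derivation.leibniz, smul_eq_mul, smul_eq_mul,
      mul_add]
    have h1 := h a (Finset.mem_insert_self a s)
    have h2 := ih fun i hi => h i (Finset.mem_insert_of_mem hi)
    linear_combination F a * h2 + (∏ i ∈ s, F i) * h1

/-- Two power series with constant term `1` and logarithmic derivatives agreeing up to degree `N`
agree up to degree `N`. -/
theorem coeff_eq_of_X_mul_derivative [CharZero L] {F G R S : L⟦X⟧} (hF : PowerSeries.X * d⁄dX L F = R * F)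
    (hG : PowerSeries.X * d⁄dX L G = S * G) (hF0 : PowerSeries.coeff 0 F = PowerSeries.coeff 0 G)
    (hR0 : PowerSeries.coeff 0 R = 0) {N : ℕ}
    (hRS : ∀ i ≤ N, PowerSeries.coeff i R = PowerSeries.coeff i S) :
    ∀ n ≤ N, PowerSeries.coeff n F = PowerSeries.coeff n G := by
  intro n
  induction n using Nat.strong_induction_on with
  | _ n ih =>
    intro hn
    rcases n with _ | n
    · exact hF0
    have e : ∀ H : L⟦X⟧, PowerSeries.coeff (n + 1) (PowerSeries.X * d⁄dX L H) =
        PowerSeries.coeff (n + 1) H * (n + 1) := fun H => by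
      rw [PowerSeries.coeff_succ_X_mul, PowerSeries.coeff_derivative]
    have h2 : (n : L) + 1 ≠ 0 := Nat.cast_add_one_ne_zero n
    refine mul_right_cancel₀ h2 ?_
    rw [← e, ← e, hF, hG, PowerSeries.coeff_mul, PowerSeries.coeff_mul]
    refine Finset.sum_congr rfl fun p hp => ?_
    have hp' : p.1 + p.2 = n + 1 := Finset.HasAntidiagonal.mem_antidiagonal.1 hp
    rw [← hRS p.1 (by omega)]
    rcases Nat.eq_zero_or_pos p.1 with h0 | h0
    · rw [h0, hR0, zero_mul, zero_mul]
    · rw [ih p.2 (by omega) (by omega)]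

/-- The sum over partitions is determined by `∑ i w_i X^i`, the logarithmic derivative of its
generating function. -/
theorem sum_partition_eq_coeff_of_derivative [CharZero L] (w : ℕ → L) {G S : L⟦X⟧}
    (hG : PowerSeries.X * d⁄dX L G = S * G) (hG0 : PowerSeries.coeff 0 G = 1)
    (hS : ∀ i, PowerSeries.coeff (i + 1) S = (i + 1 : ℕ) * w i) (hS0 : PowerSeries.coeff 0 S = 0)
    (n : ℕ) :
    ∑ lam : Nat.Partition n, ∏ i ∈ Finset.range lam.parts.card,
      w i ^ (part lam i - part lam (i + 1)) / ((part lam i - part lam (i + 1)).factorial : L) =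
    PowerSeries.coeff n G := by
  rw [sum_partition_eq_coeff]
  have hR : ∀ i, PowerSeries.coeff i (∑ j ∈ Finset.range n,
      PowerSeries.C ((j + 1 : ℕ) * w j) * PowerSeries.X ^ (j + 1) : L⟦X⟧) =
        ∑ j ∈ Finset.range n, if i = j + 1 then ((j + 1 : ℕ) * w j) else 0 := by
    intro i
    rw [map_sum]
    refine Finset.sum_congr rfl fun j _ => ?_
    rw [PowerSeries.coeff_C_mul, PowerSeries.coeff_X_pow, mul_ite, mul_one, mul_zero]
  have hR0 : PowerSeries.coeff 0 (∑ j ∈ Finset.range n,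
      PowerSeries.C ((j + 1 : ℕ) * w j) * PowerSeries.X ^ (j + 1) : L⟦X⟧) = 0 := by
    rw [hR]
    exact Finset.sum_eq_zero fun j _ => if_neg (by omega)
  refine coeff_eq_of_X_mul_derivative
    (X_mul_derivative_prod _ _ _ fun i _ => X_mul_derivative_expMonomial (w i) i) hG ?_ hR0
    (fun i hi => ?_) n le_rfl
  · rw [hG0, PowerSeries.coeff_zero_eq_constantCoeff_apply, map_prod]
    refine Finset.prod_eq_one fun i _ => ?_
    rw [← PowerSeries.coeff_zero_eq_constantCoeff_apply]
    simp [expMonomial]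
  · rcases i with _ | i
    · rw [hR0, hS0]
    · rw [hR, hS, Finset.sum_eq_single i]
      · simp
      · intro j _ hj
        exact if_neg (by omega)
      · intro h
        simp at h
        omega

end ExponentialFormula

/-! ### The `q`-binomial theorem -/

section QBinomial

variable {K L : Type*} [Field K] [Field L]

/-- The bracket `[y] = e(y) - e(-y)`, for `e : K → L` turning sums into products
(think of `e(y) = q^{y/2}`). -/
def bracket (e : K → L) (y : K) : L := e y - e (-y)

/-- The `q`-analogue `∏_{t<j} [a+t]/[t+1]` of the binomial coefficient `(a)_j / j!`. -/
def qRising (e : K → L) (a : K) (j : ℕ) : L :=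
  ∏ t ∈ Finset.range j, bracket e (a + t) / bracket e ((t + 1 : ℕ) : K)

/-- The generating function of `qRising`. -/
def qBinomialSeries (e : K → L) (a : K) : L⟦X⟧ := PowerSeries.mk (qRising e a)

theorem X_mul_derivative_rescale (c : L) (F : L⟦X⟧) :
    PowerSeries.X * d⁄dX L (PowerSeries.rescale c F) =
      PowerSeries.rescale c (PowerSeries.X * d⁄dX L F) := by
  ext n
  rcases n with _ | n
  · simp
  · rw [PowerSeries.coeff_succ_X_mul, PowerSeries.coeff_derivative, PowerSeries.coeff_rescale,
      PowerSeries.coeff_rescale, PowerSeries.coeff_succ_X_mul, PowerSeries.coeff_derivative]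
    ring

theorem one_sub_mul_geometric (c : L) :
    (1 - PowerSeries.C c * PowerSeries.X) * PowerSeries.mk (fun n => c ^ n) = 1 := by
  ext n
  rw [sub_mul, one_mul, map_sub, mul_assoc, PowerSeries.coeff_C_mul]
  rcases n with _ | n
  · simp
  · rw [PowerSeries.coeff_succ_X_mul, PowerSeries.coeff_mk, PowerSeries.coeff_mk,
      PowerSeries.coeff_one, if_neg (Nat.succ_ne_zero n)]
    ring

theorem map_natCast_mul_eq_pow {e : K → L} (he : ∀ x y, e (x + y) = e x * e y) (he0 : e 0 = 1)
    (x : K) (n : ℕ) : e (n * x) = e x ^ n := by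
  induction n with
  | zero => simp [he0]
  | succ n ih => rw [Nat.cast_succ, add_mul, one_mul, he, ih, pow_succ]

/-- The `q`-difference equation `(1 - q^{a/2} X) F(q^{1/2} X) = (1 - q^{-a/2} X) F(q^{-1/2} X)`. -/
theorem qBinomialSeries_difference {e : K → L} (he : ∀ x y, e (x + y) = e x * e y) (he0 : e 0 = 1)
    (hb : ∀ t : ℕ, bracket e ((t + 1 : ℕ) : K) ≠ 0) (a : K) :
    (1 - PowerSeries.C (e a) * PowerSeries.X) * PowerSeries.rescale (e 1) (qBinomialSeries e a) =
      (1 - PowerSeries.C (e (-a)) * PowerSeries.X) *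
        PowerSeries.rescale (e (-1)) (qBinomialSeries e a) := by
  ext n
  simp only [sub_mul, one_mul, map_sub, mul_assoc, PowerSeries.coeff_C_mul]
  rcases n with _ | n
  · simp
  · simp only [PowerSeries.coeff_succ_X_mul, PowerSeries.coeff_rescale, qBinomialSeries,
      PowerSeries.coeff_mk, ← map_natCast_mul_eq_pow he he0]
    have h : qRising e a (n + 1) * bracket e ((n + 1 : ℕ) : K) =
        bracket e (a + n) * qRising e a n := by
      rw [qRising, Finset.prod_range_succ, ← qRising, mul_assoc, div_mul_cancel₀ _ (hb n), mul_comm]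
    simp only [bracket, neg_add, he, mul_one, mul_neg] at h ⊢
    linear_combination h

/-- The `q`-binomial theorem: the series `F = ∑ [a]⋯[a+j-1]/([1]⋯[j]) X^j` is
`exp (∑ [i a]/(i [i]) X^i)`. -/
theorem X_mul_derivative_qBinomialSeries
    {e : K → L} (he : ∀ x y, e (x + y) = e x * e y) (he0 : e 0 = 1)
    (hb : ∀ t : ℕ, bracket e ((t + 1 : ℕ) : K) ≠ 0) (a : K) :
    PowerSeries.X * d⁄dX L (qBinomialSeries e a) =
      PowerSeries.mk (fun i : ℕ => bracket e (i * a) / bracket e (i : K)) *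
        qBinomialSeries e a := by
  set F := qBinomialSeries e a with hF
  have hF0 : PowerSeries.constantCoeff F ≠ 0 := by
    rw [← PowerSeries.coeff_zero_eq_constantCoeff_apply, hF]
    simp [qBinomialSeries, qRising]
  set R := PowerSeries.X * d⁄dX L F * F⁻¹ with hR
  have hRF : PowerSeries.X * d⁄dX L F = R * F := by
    rw [hR, mul_assoc, PowerSeries.inv_mul_cancel _ hF0, mul_one]
  -- compare the logarithmic derivatives of the two sides of the `q`-difference equation
  have hD : ∀ c d : L, PowerSeries.X * d⁄dX L ((1 - PowerSeries.C d * PowerSeries.X) *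
      PowerSeries.rescale c F) = (PowerSeries.rescale c R -
        PowerSeries.C d * PowerSeries.X * PowerSeries.mk (fun n => d ^ n)) *
          ((1 - PowerSeries.C d * PowerSeries.X) * PowerSeries.rescale c F) := by
    intro c d
    have h1 := X_mul_derivative_rescale c F
    rw [hRF, map_mul] at h1
    have h2 := one_sub_mul_geometric d
    rw [Derivation.leibniz, smul_eq_mul, smul_eq_mul, map_sub, PowerSeries.derivative_one,
      Derivation.leibniz, smul_eq_mul, smul_eq_mul, PowerSeries.derivative_C,
      PowerSeries.derivative_X]
    linear_combination (1 - PowerSeries.C d * PowerSeries.X) * h1 +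
      PowerSeries.C d * PowerSeries.X * PowerSeries.rescale c F * h2
  have hdiff := qBinomialSeries_difference he he0 hb a
  rw [← hF] at hdiff
  have h1 := hD (e 1) (e a)
  have h2 := hD (e (-1)) (e (-a))
  rw [← hdiff] at h2
  have h3 := h1.symm.trans h2
  have hne : (1 - PowerSeries.C (e a) * PowerSeries.X) * PowerSeries.rescale (e 1) F ≠ 0 := by
    intro h
    have := congrArg PowerSeries.constantCoeff h
    rw [map_mul, ← PowerSeries.coeff_zero_eq_constantCoeff_apply (PowerSeries.rescale _ _),
      PowerSeries.coeff_rescale, PowerSeries.coeff_zero_eq_constantCoeff_apply] at this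
    simp at this
    exact hF0 this
  have h4 := mul_right_cancel₀ hne h3
  rw [hRF]
  congr 1
  ext i
  rw [PowerSeries.coeff_mk]
  rcases i with _ | i
  · simp [hR, bracket]
  · have h5 := congrArg (PowerSeries.coeff (i + 1)) h4
    simp only [map_sub, mul_assoc, PowerSeries.coeff_C_mul, PowerSeries.coeff_succ_X_mul,
      PowerSeries.coeff_rescale, PowerSeries.coeff_mk, ← pow_succ'] at h5
    simp only [← map_natCast_mul_eq_pow he he0] at h5
    rw [eq_div_iff (hb i)]
    simp only [bracket, mul_one, mul_neg] at h5 ⊢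
    linear_combination h5

end QBinomial

section PartitionSum

variable {K : Type*} [Field K] [CharZero K]

theorem expU_add (c d : K) : expU (c + d) = expU c * expU d := by
  unfold expU
  rw [← PowerSeries.coe_mul, PowerSeries.exp_mul_exp_eq_exp_add]

theorem expU_zero : expU (0 : K) = 1 := by
  unfold expU
  rw [← PowerSeries.coe_one]
  congr 1
  ext n
  rcases n with _ | n <;> simp [PowerSeries.coeff_one]

theorem zetaU_neg (c : K) : zetaU (-c) = -zetaU c := by
  unfold zetaU
  rw [neg_div, neg_neg]
  ring

instance : CharZero (LaurentSeries K) :=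
  charZero_of_injective_algebraMap (algebraMap K (LaurentSeries K)).injective

theorem zetaU_ne_zero {c : K} (hc : c ≠ 0) : zetaU c ≠ 0 := by
  intro h
  have h1 := congrArg (fun f : LaurentSeries K => f.coeff ((1 : ℕ) : ℤ)) h
  simp only [zetaU, expU, HahnSeries.coeff_sub, LaurentSeries.coeff_coe_powerSeries,
    PowerSeries.coeff_rescale, PowerSeries.coeff_exp, HahnSeries.coeff_zero] at h1
  simp at h1
  exact hc h1

/-- The `q`-rising factorials `∏_{t<j} ζ((a+t)u/b) / ζ((t+1)u/b)`. -/
def zetaRising (b a : K) (j : ℕ) : LaurentSeries K :=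
  ∏ t ∈ Finset.range j, zetaU ((a + t) / b) / zetaU (((t + 1 : ℕ) : K) / b)

/-- The generating function `exp (∑ p_i^* ζ(ium) X^i / i)` of the sums over partitions factors,
by the `q`-binomial theorem. -/
theorem partitionSum_eq_sum (P Q : ℤ) (hP : P ≠ 0) (hQ : Q ≠ 0) (t : K) (ht : t ≠ 0) (m n : ℕ) :
    partitionSum P Q t m n =
      ∑ p ∈ Finset.HasAntidiagonal.antidiagonal n,
        algebraMap K (LaurentSeries K) (((t ^ Q)⁻¹) ^ p.1 * (t ^ Q) ^ p.2) *
          (zetaRising (bParam K P Q) (-(m * bParam K P Q)) p.1 *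
            zetaRising (bParam K P Q) (m * bParam K P Q) p.2) := by
  set b := bParam K P Q with hb
  have hb0 : b ≠ 0 := by
    rw [hb, bParam]
    exact div_ne_zero (Int.cast_ne_zero.2 hP) (Int.cast_ne_zero.2 hQ)
  set A := t ^ Q with hA
  have hA0 : A ≠ 0 := zpow_ne_zero _ ht
  set a := (m : K) * b with ha
  let e : K → LaurentSeries K := fun y => expU (y / b / 2)
  have hbr : ∀ y, bracket e y = zetaU (y / b) := fun y => by
    simp only [bracket, e, zetaU, neg_div]
  have he : ∀ x y, e (x + y) = e x * e y := fun x y => by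
    simp only [e, ← expU_add, add_div]
  have he0 : e 0 = 1 := by simp only [e, zero_div, expU_zero]
  have hne : ∀ t : ℕ, bracket e ((t + 1 : ℕ) : K) ≠ 0 := fun t => by
    rw [hbr]
    exact zetaU_ne_zero (div_ne_zero (Nat.cast_ne_zero.2 (Nat.succ_ne_zero t)) hb0)
  have hq : ∀ a j, qRising e a j = zetaRising b a j := fun a j => by
    simp only [qRising, zetaRising, hbr]
  set c : K → LaurentSeries K := fun y => algebraMap K (LaurentSeries K) y with hc
  let G : (LaurentSeries K)⟦X⟧ :=
    PowerSeries.rescale (c A⁻¹) (qBinomialSeries e (-a)) * PowerSeries.rescale (c A) (qBinomialSeries e a)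
  have hG : PowerSeries.X * d⁄dX (LaurentSeries K) G =
      (PowerSeries.rescale (c A⁻¹)
          (PowerSeries.mk fun i : ℕ => bracket e (i * -a) / bracket e (i : K)) +
        PowerSeries.rescale (c A)
          (PowerSeries.mk fun i : ℕ => bracket e (i * a) / bracket e (i : K))) * G := by
    have h1 := X_mul_derivative_rescale (c A⁻¹) (qBinomialSeries e (-a))
    have h2 := X_mul_derivative_rescale (c A) (qBinomialSeries e a)
    rw [X_mul_derivative_qBinomialSeries he he0 hne, map_mul] at h1 h2
    simp only [G]
    rw [Derivation.leibniz, smul_eq_mul, smul_eq_mul]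
    linear_combination PowerSeries.rescale (c A⁻¹) (qBinomialSeries e (-a)) * h2 +
      PowerSeries.rescale (c A) (qBinomialSeries e a) * h1
  have key := sum_partition_eq_coeff_of_derivative
    (fun i => pStar P Q t (i + 1) / ((i + 1 : ℕ) : LaurentSeries K) *
      zetaU (((i + 1 : ℕ) : K) * (m : K))) hG ?_ (fun i => ?_) ?_ n
  · rw [partitionSum, key, PowerSeries.coeff_mul]
    refine Finset.sum_congr rfl fun p _ => ?_
    simp only [PowerSeries.coeff_rescale, qBinomialSeries, PowerSeries.coeff_mk, hq, hc, map_mul,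
      map_pow]
    ring
  · simp only [G, PowerSeries.coeff_mul, Finset.Nat.antidiagonal_zero, Finset.sum_singleton,
      PowerSeries.coeff_rescale, qBinomialSeries, PowerSeries.coeff_mk]
    simp [qRising]
  · simp only [map_add, PowerSeries.coeff_rescale, PowerSeries.coeff_mk, hbr]
    have e1 : ((i + 1 : ℕ) : K) * -a / b = -(((i + 1 : ℕ) : K) * m) := by
      rw [ha]; field_simp
    have e2 : ((i + 1 : ℕ) : K) * a / b = ((i + 1 : ℕ) : K) * m := by
      rw [ha]; field_simp
    have hi : ((i + 1 : ℕ) : LaurentSeries K) ≠ 0 := Nat.cast_ne_zero.2 (Nat.succ_ne_zero i)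
    rw [e1, e2, zetaU_neg, pStar, ← hb, ← hA]
    simp only [hc, map_sub, map_pow, map_inv₀, inv_pow]
    field_simp
    ring
  · simp only [map_add, PowerSeries.coeff_rescale, PowerSeries.coeff_mk]
    simp [bracket]

end PartitionSum

/-! ### Expansion of the `q`-rising factorials in `u` -/

section BiPoly

variable (K : Type*) [Field K]

/-- The functions of `(m, j)` given by polynomials of total degree at most `d`. -/
def biPoly (d : ℕ) : Submodule K (ℕ → ℕ → K) :=
  Submodule.span K {f | ∃ α β : ℕ, α + β ≤ d ∧ f = fun m j : ℕ => (m : K) ^ α * (j : K) ^ β}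

variable {K}

theorem monomial_mem_biPoly {d α β : ℕ} (h : α + β ≤ d) :
    (fun m j : ℕ => (m : K) ^ α * (j : K) ^ β) ∈ biPoly K d :=
  Submodule.subset_span ⟨α, β, h, rfl⟩

theorem biPoly_mono {d e : ℕ} (h : d ≤ e) : biPoly K d ≤ biPoly K e :=
  Submodule.span_mono fun _ ⟨α, β, hd, hf⟩ => ⟨α, β, hd.trans h, hf⟩

theorem const_mem_biPoly (c : K) (d : ℕ) : (fun _ _ => c) ∈ biPoly K d := by
  have h := (biPoly K d).smul_mem c (monomial_mem_biPoly (K := K) (α := 0) (β := 0) (Nat.zero_le d))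
  convert! h using 1
  ext m j
  simp

theorem natCast_fst_mem_biPoly : (fun m _ : ℕ => (m : K)) ∈ biPoly K 1 := by
  simpa using monomial_mem_biPoly (K := K) (d := 1) (α := 1) (β := 0) le_rfl

theorem natCast_snd_mem_biPoly : (fun _ j : ℕ => (j : K)) ∈ biPoly K 1 := by
  simpa using monomial_mem_biPoly (K := K) (d := 1) (α := 0) (β := 1) le_rfl

theorem const_mul_mem_biPoly (c : K) {d : ℕ} {f : ℕ → ℕ → K} (hf : f ∈ biPoly K d) :
    (fun m j => c * f m j) ∈ biPoly K d :=
  (biPoly K d).smul_mem c hf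

theorem mul_mem_biPoly {d e : ℕ} {f g : ℕ → ℕ → K} (hf : f ∈ biPoly K d) (hg : g ∈ biPoly K e) :
    (fun m j => f m j * g m j) ∈ biPoly K (d + e) := by
  change f * g ∈ _
  induction hf using Submodule.span_induction with
  | zero => rw [zero_mul]; exact Submodule.zero_mem _
  | add x y _ _ hx hy => rw [add_mul]; exact Submodule.add_mem _ hx hy
  | smul c x _ hx => rw [smul_mul_assoc]; exact Submodule.smul_mem _ c hx
  | mem x hx =>
    obtain ⟨α, β, hd, rfl⟩ := hx
    induction hg using Submodule.span_induction with
    | zero => rw [mul_zero]; exact Submodule.zero_mem _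
    | add x y _ _ hx hy => rw [mul_add]; exact Submodule.add_mem _ hx hy
    | smul c x _ hx => rw [mul_smul_comm]; exact Submodule.smul_mem _ c hx
    | mem x hx =>
      obtain ⟨γ, δ, he, rfl⟩ := hx
      have h := monomial_mem_biPoly (K := K) (d := d + e) (α := α + γ) (β := β + δ) (by omega)
      convert! h using 1
      ext m j
      simp only [Pi.mul_apply]
      ring

theorem pow_mem_biPoly {d : ℕ} {f : ℕ → ℕ → K} (hf : f ∈ biPoly K d) (n : ℕ) :
    (fun m j => f m j ^ n) ∈ biPoly K (n * d) := by
  induction n with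
  | zero => simpa using const_mem_biPoly (1 : K) 0
  | succ n ih =>
    have h := mul_mem_biPoly ih hf
    rw [Nat.succ_mul]
    simpa only [pow_succ] using h

theorem sum_mem_biPoly {ι : Type*} {d : ℕ} (s : Finset ι) {f : ι → ℕ → ℕ → K}
    (hf : ∀ i ∈ s, f i ∈ biPoly K d) : (fun m j => ∑ i ∈ s, f i m j) ∈ biPoly K d := by
  have h := Submodule.sum_mem (biPoly K d) hf
  convert! h using 1
  ext m j
  simp only [Finset.sum_apply]

/-- Substituting a polynomial of degree at most `1` for `j`. -/
theorem exists_biPoly_subst {d : ℕ} {f h : ℕ → ℕ → K} (hf : f ∈ biPoly K d) (hh : h ∈ biPoly K 1) :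
    ∃ g ∈ biPoly K d, ∀ m j i : ℕ, (i : K) = h m j → g m j = f m i := by
  induction hf using Submodule.span_induction with
  | zero => exact ⟨0, Submodule.zero_mem _, fun _ _ _ _ => rfl⟩
  | add x y _ _ hx hy =>
    obtain ⟨g₁, h₁, e₁⟩ := hx
    obtain ⟨g₂, h₂, e₂⟩ := hy
    refine ⟨g₁ + g₂, Submodule.add_mem _ h₁ h₂, fun m j i hi => ?_⟩
    simp only [Pi.add_apply, e₁ m j i hi, e₂ m j i hi]
  | smul c x _ hx =>
    obtain ⟨g₁, h₁, e₁⟩ := hx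
    refine ⟨c • g₁, Submodule.smul_mem _ c h₁, fun m j i hi => ?_⟩
    simp only [Pi.smul_apply, e₁ m j i hi]
  | mem x hx =>
    obtain ⟨α, β, hd, rfl⟩ := hx
    refine ⟨fun m j : ℕ => (m : K) ^ α * h m j ^ β, ?_, fun m j i hi => by simp only [hi]⟩
    have h1 := mul_mem_biPoly (pow_mem_biPoly (natCast_fst_mem_biPoly (K := K)) α)
      (pow_mem_biPoly hh β)
    exact biPoly_mono (by omega) h1

theorem shift_mem_biPoly {d : ℕ} {f : ℕ → ℕ → K} (hf : f ∈ biPoly K d) :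
    (fun m j => f m (j + 1)) ∈ biPoly K d := by
  obtain ⟨g, hg, e⟩ := exists_biPoly_subst hf
    ((biPoly K 1).add_mem natCast_snd_mem_biPoly (const_mem_biPoly (1 : K) 1))
  convert! hg using 1
  ext m j
  exact (e m j (j + 1) (by simp)).symm

/-- Indefinite summation raises the degree by one, by Faulhaber's formula. -/
theorem sum_range_mem_biPoly [CharZero K] {d : ℕ} {f : ℕ → ℕ → K} (hf : f ∈ biPoly K d) :
    (fun m j => ∑ t ∈ Finset.range j, f m t) ∈ biPoly K (d + 1) := by
  induction hf using Submodule.span_induction with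
  | zero => simpa using const_mem_biPoly (0 : K) (d + 1)
  | add x y _ _ hx hy =>
    have h := Submodule.add_mem _ hx hy
    convert! h using 1
    ext m j
    simp only [Pi.add_apply, Finset.sum_add_distrib]
  | smul c x _ hx =>
    have h := Submodule.smul_mem _ c hx
    convert! h using 1
    ext m j
    simp only [Pi.smul_apply, Finset.smul_sum]
  | mem x hx =>
    obtain ⟨α, β, hd, rfl⟩ := hx
    have key : (fun m j : ℕ => ∑ t ∈ Finset.range j, (m : K) ^ α * (t : K) ^ β) =
        fun m j : ℕ => ∑ i ∈ Finset.range (β + 1),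
          ((_root_.bernoulli i * ((β + 1).choose i : ℚ) / (β + 1) : ℚ) : K) *
            ((m : K) ^ α * (j : K) ^ (β + 1 - i)) := by
      ext m j
      rw [← Finset.mul_sum]
      have h := congrArg (fun q : ℚ => (q : K)) (sum_range_pow j β)
      push_cast at h
      rw [h, Finset.mul_sum]
      refine Finset.sum_congr rfl fun i _ => ?_
      push_cast
      ring
    rw [key]
    exact sum_mem_biPoly _ fun i _ => const_mul_mem_biPoly _ (monomial_mem_biPoly (by omega))

end BiPoly

section Expansion

variable {K : Type*} [Field K] [CharZero K]

variable (K) in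
/-- The power series `ζ(u) / u = (e^{u/2} - e^{-u/2}) / u`. -/
def zetaSeries : K⟦X⟧ :=
  PowerSeries.mk fun k => ((1 / 2) ^ (k + 1) - (-(1 / 2)) ^ (k + 1)) / ((k + 1).factorial : K)

theorem constantCoeff_zetaSeries : PowerSeries.constantCoeff (zetaSeries K) = 1 := by
  rw [← PowerSeries.coeff_zero_eq_constantCoeff_apply, zetaSeries, PowerSeries.coeff_mk]
  norm_num

theorem constantCoeff_rescale {K : Type*} [Field K] (c : K) (F : K⟦X⟧) :
    PowerSeries.constantCoeff (PowerSeries.rescale c F) = PowerSeries.constantCoeff F := by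
  rw [← PowerSeries.coeff_zero_eq_constantCoeff_apply, PowerSeries.coeff_rescale]
  simp

theorem zetaU_eq (c : K) : zetaU c =
    ((PowerSeries.C c * (PowerSeries.X * PowerSeries.rescale c (zetaSeries K)) : K⟦X⟧) :
      LaurentSeries K) := by
  unfold zetaU expU
  rw [← PowerSeries.coe_sub]
  congr 1
  ext k
  rw [map_sub, PowerSeries.coeff_C_mul, PowerSeries.coeff_rescale, PowerSeries.coeff_rescale]
  rcases k with _ | k
  · simp
  · rw [PowerSeries.coeff_succ_X_mul, PowerSeries.coeff_rescale, zetaSeries, PowerSeries.coeff_mk,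
      PowerSeries.coeff_exp]
    have e1 : c / 2 = c * (1 / 2) := by ring
    have e2 : -(c / 2) = c * (-(1 / 2)) := by ring
    rw [e1, ← mul_neg, mul_pow, mul_pow]
    simp only [map_div₀, map_one, map_natCast]
    ring

/-- `(a)_j / j!`, the coefficient of `X^j` in `(1 - X)^{-a}`. -/
def risingCoeff (a : K) (j : ℕ) : K := ∏ t ∈ Finset.range j, (a + t) / (t + 1)

/-- The correction factor `∏_{t<j} S((a+t)u/b) / S((t+1)u/b)`, where `S(u) = ζ(u) / u`. -/
def zetaCorrection (b a : K) (j : ℕ) : K⟦X⟧ :=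
  ∏ t ∈ Finset.range j, PowerSeries.rescale ((a + t) / b) (zetaSeries K) *
    (PowerSeries.rescale (((t + 1 : ℕ) : K) / b) (zetaSeries K))⁻¹

theorem zetaRising_eq {b : K} (hb : b ≠ 0) (a : K) (j : ℕ) : zetaRising b a j =
    ((PowerSeries.C (risingCoeff a j) * zetaCorrection b a j : K⟦X⟧) : LaurentSeries K) := by
  rw [risingCoeff, zetaCorrection, zetaRising, map_prod, ← Finset.prod_mul_distrib, map_prod]
  refine Finset.prod_congr rfl fun t _ => ?_
  have ht : ((t + 1 : ℕ) : K) ≠ 0 := Nat.cast_ne_zero.2 (Nat.succ_ne_zero t)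
  rw [div_eq_iff (zetaU_ne_zero (div_ne_zero ht hb)), zetaU_eq, zetaU_eq, ← PowerSeries.coe_mul]
  congr 1
  have h1 : (PowerSeries.rescale (((t + 1 : ℕ) : K) / b) (zetaSeries K))⁻¹ *
      PowerSeries.rescale (((t + 1 : ℕ) : K) / b) (zetaSeries K) = 1 := by
    refine PowerSeries.inv_mul_cancel _ ?_
    rw [constantCoeff_rescale, constantCoeff_zetaSeries]
    exact one_ne_zero
  have h2 : (PowerSeries.C ((a + t) / b) : K⟦X⟧) =
      PowerSeries.C ((a + t) / (t + 1)) * PowerSeries.C (((t + 1 : ℕ) : K) / b) := by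
    rw [← map_mul]
    congr 1
    push_cast at ht ⊢
    field_simp
  rw [h2]
  linear_combination (-(PowerSeries.C ((a + t) / (t + 1)) * PowerSeries.C (((t + 1 : ℕ) : K) / b) *
    PowerSeries.X * PowerSeries.rescale ((a + t) / b) (zetaSeries K))) * h1

theorem zetaCorrection_zero {K : Type*} [Field K] (b a : K) : zetaCorrection b a 0 = 1 := by
  simp [zetaCorrection]

theorem constantCoeff_zetaCorrection (b a : K) (j : ℕ) :
    PowerSeries.coeff 0 (zetaCorrection b a j) = 1 := by
  rw [PowerSeries.coeff_zero_eq_constantCoeff_apply, zetaCorrection, map_prod]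
  refine Finset.prod_eq_one fun t _ => ?_
  rw [map_mul, PowerSeries.constantCoeff_inv, constantCoeff_rescale, constantCoeff_rescale,
    constantCoeff_zetaSeries]
  simp

theorem zetaCorrection_succ_mul (b a : K) (j : ℕ) :
    zetaCorrection b a (j + 1) * PowerSeries.rescale (((j + 1 : ℕ) : K) / b) (zetaSeries K) =
      zetaCorrection b a j * PowerSeries.rescale ((a + j) / b) (zetaSeries K) := by
  have h1 : (PowerSeries.rescale (((j + 1 : ℕ) : K) / b) (zetaSeries K))⁻¹ *
      PowerSeries.rescale (((j + 1 : ℕ) : K) / b) (zetaSeries K) = 1 := by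
    refine PowerSeries.inv_mul_cancel _ ?_
    rw [constantCoeff_rescale, constantCoeff_zetaSeries]
    exact one_ne_zero
  rw [zetaCorrection, Finset.prod_range_succ, ← zetaCorrection]
  linear_combination (zetaCorrection b a j * PowerSeries.rescale ((a + j) / b) (zetaSeries K)) * h1

/-- The `u^k`-coefficient of the correction factor is a polynomial in `a` and `j` of total degree at
most `2k`: its difference in `j` is built from the lower coefficients. -/
theorem coeff_zetaCorrection_mem (b c : K) (k : ℕ) :
    (fun m j : ℕ => PowerSeries.coeff k (zetaCorrection b (m * c) j)) ∈ biPoly K (2 * k) := by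
  induction k using Nat.strong_induction_on with
  | _ k ih =>
  rcases k with _ | k
  · simp only [constantCoeff_zetaCorrection]
    exact const_mem_biPoly 1 _
  let Φ : ℕ → ℕ → ℕ → K := fun k m j => PowerSeries.coeff k (zetaCorrection b (m * c) j)
  let σ : ℕ → K := fun q => PowerSeries.coeff q (zetaSeries K)
  have hσ : σ 0 = 1 := by
    simp only [σ, PowerSeries.coeff_zero_eq_constantCoeff_apply, constantCoeff_zetaSeries]
  have hstep : ∀ m j, Φ (k + 1) m (j + 1) = Φ (k + 1) m j +
      ∑ p ∈ Finset.HasAntidiagonal.antidiagonal k,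
        (Φ p.1 m j * (σ (p.2 + 1) * ((m * c + j) / b) ^ (p.2 + 1)) -
          Φ p.1 m (j + 1) * (σ (p.2 + 1) * ((j + 1) / b) ^ (p.2 + 1))) := by
    intro m j
    have h := congrArg (PowerSeries.coeff (k + 1)) (zetaCorrection_succ_mul b (m * c) j)
    rw [PowerSeries.coeff_mul, PowerSeries.coeff_mul, Finset.Nat.sum_antidiagonal_succ',
      Finset.Nat.sum_antidiagonal_succ'] at h
    simp only [PowerSeries.coeff_rescale, pow_zero, one_mul] at h
    rw [Finset.sum_sub_distrib]
    simp only [Φ, σ] at hσ ⊢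
    rw [hσ] at h
    push_cast at h
    simp only [mul_comm (PowerSeries.coeff _ (zetaSeries K))]
    linear_combination h
  have hsum : ∀ m j, Φ (k + 1) m j = ∑ t ∈ Finset.range j,
      ∑ p ∈ Finset.HasAntidiagonal.antidiagonal k,
        (Φ p.1 m t * (σ (p.2 + 1) * ((m * c + t) / b) ^ (p.2 + 1)) -
          Φ p.1 m (t + 1) * (σ (p.2 + 1) * ((t + 1) / b) ^ (p.2 + 1))) := by
    intro m j
    induction j with
    | zero => simp [Φ, zetaCorrection_zero, PowerSeries.coeff_one]
    | succ j ih => rw [hstep, ih, Finset.sum_range_succ]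
  have hfun : (fun m j : ℕ => Φ (k + 1) m j) = fun m j => _ := funext fun m => funext (hsum m)
  change (fun m j : ℕ => Φ (k + 1) m j) ∈ _
  rw [hfun]
  refine biPoly_mono (show 2 * k + 1 + 1 ≤ 2 * (k + 1) by omega) (sum_range_mem_biPoly
    (f := fun m t => ∑ p ∈ Finset.HasAntidiagonal.antidiagonal k,
        (Φ p.1 m t * (σ (p.2 + 1) * ((m * c + t) / b) ^ (p.2 + 1)) -
          Φ p.1 m (t + 1) * (σ (p.2 + 1) * ((t + 1) / b) ^ (p.2 + 1)))) ?_)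
  refine sum_mem_biPoly _ fun p hp => ?_
  have hp' : p.1 + p.2 = k := Finset.HasAntidiagonal.mem_antidiagonal.1 hp
  have hΦ : (fun m j => Φ p.1 m j) ∈ biPoly K (2 * p.1) := ih p.1 (by omega)
  have hl1 : (fun m t : ℕ => ((m : K) * c + t) / b) ∈ biPoly K 1 := by
    have h := (biPoly K 1).add_mem (const_mul_mem_biPoly (c / b) natCast_fst_mem_biPoly)
      (const_mul_mem_biPoly (1 / b) natCast_snd_mem_biPoly)
    convert! h using 1
    ext m t
    simp only [Pi.add_apply]
    ring
  have hl2 : (fun _ t : ℕ => ((t : K) + 1) / b) ∈ biPoly K 1 := by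
    have h := (biPoly K 1).add_mem (const_mem_biPoly (1 / b) 1)
      (const_mul_mem_biPoly (1 / b) natCast_snd_mem_biPoly)
    convert! h using 1
    ext m t
    simp only [Pi.add_apply]
    ring
  refine biPoly_mono (show 2 * p.1 + (p.2 + 1) * 1 ≤ 2 * k + 1 by omega) (Submodule.sub_mem _ ?_ ?_)
  · exact mul_mem_biPoly hΦ (const_mul_mem_biPoly _ (pow_mem_biPoly hl1 _))
  · exact mul_mem_biPoly (shift_mem_biPoly hΦ) (const_mul_mem_biPoly _ (pow_mem_biPoly hl2 _))

end Expansion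

/-! ### Jacobi polynomials and the hypergeometric equation -/

section Hypergeometric

variable {K : Type*} [Field K]

theorem risingCoeff_succ [CharZero K] (α : K) (j : ℕ) :
    ((j : K) + 1) * risingCoeff α (j + 1) = (α + j) * risingCoeff α j := by
  have h : (j : K) + 1 ≠ 0 := Nat.cast_add_one_ne_zero j
  rw [risingCoeff, Finset.prod_range_succ, ← risingCoeff]
  field_simp

theorem mul_risingCoeff_add_one [CharZero K] (α : K) (j : ℕ) :
    α * risingCoeff (α + 1) j = (α + j) * risingCoeff α j := by
  induction j with
  | zero => simp [risingCoeff]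
  | succ j ih =>
    have h : (j : K) + 1 ≠ 0 := Nat.cast_add_one_ne_zero j
    refine mul_left_cancel₀ h ?_
    have h1 := risingCoeff_succ α j
    have h2 := risingCoeff_succ (α + 1) j
    push_cast
    linear_combination α * h2 - (α + j + 1) * h1 + (α + 1 + j) * ih

/-- The binomial series `(1 - X)^{-α}`. -/
def risingSeries (α : K) : K⟦X⟧ := PowerSeries.mk (risingCoeff α)

theorem derivative_risingSeries [CharZero K] (α : K) :
    d⁄dX K (risingSeries α) = PowerSeries.C α * risingSeries (α + 1) := by
  ext j
  rw [PowerSeries.coeff_derivative, PowerSeries.coeff_C_mul, risingSeries, risingSeries,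
    PowerSeries.coeff_mk, PowerSeries.coeff_mk, mul_risingCoeff_add_one, ← risingCoeff_succ,
    mul_comm]

theorem one_sub_X_mul_risingSeries [CharZero K] (α : K) :
    (1 - PowerSeries.X) * risingSeries (α + 1) = risingSeries α := by
  ext j
  rw [sub_mul, one_mul, map_sub]
  rcases j with _ | j
  · simp [risingSeries, risingCoeff]
  · rw [PowerSeries.coeff_succ_X_mul]
    simp only [risingSeries, PowerSeries.coeff_mk]
    have h : (j : K) + 1 ≠ 0 := Nat.cast_add_one_ne_zero j
    refine mul_left_cancel₀ h ?_
    linear_combination risingCoeff_succ (α + 1) j - risingCoeff_succ α j +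
      mul_risingCoeff_add_one α j

theorem derivative_rescale (c : K) (F : K⟦X⟧) :
    d⁄dX K (PowerSeries.rescale c F) = PowerSeries.C c * PowerSeries.rescale c (d⁄dX K F) := by
  ext n
  rw [PowerSeries.coeff_C_mul, PowerSeries.coeff_derivative, PowerSeries.coeff_rescale,
    PowerSeries.coeff_rescale, PowerSeries.coeff_derivative]
  ring

theorem rescale_C (c d : K) : PowerSeries.rescale c (PowerSeries.C d) = PowerSeries.C d := by
  ext n
  rw [PowerSeries.coeff_rescale, PowerSeries.coeff_C]
  split_ifs with h
  · simp [h]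
  · simp

/-- The series `(1 - X)^{a-1} (1 - xX)^{-a-1}`, whose coefficients are Jacobi polynomials. -/
def jacobiSeries (a x : K) : K⟦X⟧ :=
  risingSeries (1 - a) * PowerSeries.rescale x (risingSeries (a + 1))

/-- The coefficient of `X^{n-1}` in `(1 - X)^{a-1} (1 - xX)^{-a-1}`, and `0` for `n = 0`. -/
def jacobiCoeff (a x : K) (n : ℕ) : K := PowerSeries.coeff n (PowerSeries.X * jacobiSeries a x)

theorem jacobiCoeff_zero (a x : K) : jacobiCoeff a x 0 = 0 := by
  simp [jacobiCoeff]

theorem jacobiCoeff_succ (a x : K) (n : ℕ) :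
    jacobiCoeff a x (n + 1) = PowerSeries.coeff n (jacobiSeries a x) := by
  rw [jacobiCoeff, PowerSeries.coeff_succ_X_mul]

theorem rescale_one_sub_X_mul [CharZero K] (a x : K) :
    (1 - PowerSeries.C x * PowerSeries.X) * PowerSeries.rescale x (risingSeries (a + 1)) =
      PowerSeries.rescale x (risingSeries a) := by
  have h := congrArg (PowerSeries.rescale x) (one_sub_X_mul_risingSeries a)
  rwa [map_mul, map_sub, map_one, PowerSeries.rescale_X] at h

theorem derivative_rescale_risingSeries [CharZero K] (a x : K) :
    d⁄dX K (PowerSeries.rescale x (risingSeries a)) =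
      PowerSeries.C x * (PowerSeries.C a * PowerSeries.rescale x (risingSeries (a + 1))) := by
  rw [derivative_rescale, derivative_risingSeries, map_mul, rescale_C]

/-- The three-term recurrence of the Jacobi polynomials in the degree. -/
theorem jacobiCoeff_recurrence [CharZero K] (a x : K) {n : ℕ} (hn : 1 ≤ n) :
    (n : K) * jacobiCoeff a x (n + 1) =
      (n * (1 + x) + a * (x - 1)) * jacobiCoeff a x n - x * n * jacobiCoeff a x (n - 1) := by
  obtain ⟨k, rfl⟩ : ∃ k, n = k + 1 := ⟨n - 1, by omega⟩
  have hU : d⁄dX K (jacobiSeries a x) *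
      ((1 - PowerSeries.X) * (1 - PowerSeries.C x * PowerSeries.X)) =
        jacobiSeries a x * (PowerSeries.C (1 - a) * (1 - PowerSeries.C x * PowerSeries.X) +
          PowerSeries.C x * PowerSeries.C (a + 1) * (1 - PowerSeries.X)) := by
    unfold jacobiSeries
    rw [Derivation.leibniz, smul_eq_mul, smul_eq_mul, derivative_rescale_risingSeries,
      derivative_risingSeries]
    have h1 := one_sub_X_mul_risingSeries (1 - a)
    have h2 := rescale_one_sub_X_mul (a + 1) x
    linear_combination (PowerSeries.C (1 - a) * (1 - PowerSeries.C x * PowerSeries.X) *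
      PowerSeries.rescale x (risingSeries (a + 1))) * h1 +
      (PowerSeries.C x * PowerSeries.C (a + 1) * (1 - PowerSeries.X) * risingSeries (1 - a)) * h2
  set U := jacobiSeries a x with hUdef
  have hU' : d⁄dX K U - PowerSeries.C (1 + x) * (PowerSeries.X * d⁄dX K U) +
      PowerSeries.C x * (PowerSeries.X * (PowerSeries.X * d⁄dX K U)) =
        PowerSeries.C (1 - a + x * (a + 1)) * U -
          PowerSeries.C (2 * x) * (PowerSeries.X * U) := by
    simp only [map_add, map_sub, map_mul, map_one, map_ofNat] at hU ⊢
    linear_combination hU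
  have hcoeff : ∀ c₁ c₂ c₃ c₄ : K, d⁄dX K U - PowerSeries.C c₁ * (PowerSeries.X * d⁄dX K U) +
      PowerSeries.C c₂ * (PowerSeries.X * (PowerSeries.X * d⁄dX K U)) =
        PowerSeries.C c₃ * U - PowerSeries.C c₄ * (PowerSeries.X * U) →
      PowerSeries.coeff k (d⁄dX K U) - c₁ * PowerSeries.coeff k (PowerSeries.X * d⁄dX K U) +
        c₂ * PowerSeries.coeff k (PowerSeries.X * (PowerSeries.X * d⁄dX K U)) =
          c₃ * PowerSeries.coeff k U - c₄ * PowerSeries.coeff k (PowerSeries.X * U) := by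
    intro c₁ c₂ c₃ c₄ h
    simpa only [map_add, map_sub, PowerSeries.coeff_C_mul] using congrArg (PowerSeries.coeff k) h
  have h := hcoeff _ _ _ _ hU'
  rw [Nat.add_sub_cancel, jacobiCoeff_succ, jacobiCoeff_succ, ← hUdef]
  rcases k with _ | k
  · rw [jacobiCoeff_zero]
    simp only [PowerSeries.coeff_zero_X_mul, PowerSeries.coeff_derivative] at h
    push_cast at h ⊢
    linear_combination h
  · rw [jacobiCoeff_succ, ← hUdef]
    simp only [PowerSeries.coeff_succ_X_mul, PowerSeries.coeff_derivative] at h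
    rcases k with _ | k
    · simp only [PowerSeries.coeff_zero_X_mul] at h
      push_cast at h ⊢
      linear_combination h
    · simp only [PowerSeries.coeff_succ_X_mul, PowerSeries.coeff_derivative] at h
      push_cast at h ⊢
      linear_combination h

/-- The sum `∑_{i+j=n} q(j) (-a)_i/i! (a)_j/j! x^j`: the polynomial `q(x d/dx)` applied to
the coefficient of `X^n` in `(1 - X)^a (1 - xX)^{-a}`. -/
def hyperSum (a x : K) (n : ℕ) (q : ℕ → K) : K :=
  ∑ p ∈ Finset.HasAntidiagonal.antidiagonal n,
    q p.2 * (risingCoeff (-a) p.1 * (risingCoeff a p.2 * x ^ p.2))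

theorem hyperSum_add (a x : K) (n : ℕ) (q r : ℕ → K) :
    hyperSum a x n (fun j => q j + r j) = hyperSum a x n q + hyperSum a x n r := by
  simp only [hyperSum, add_mul, Finset.sum_add_distrib]

theorem hyperSum_const_mul (a x c : K) (n : ℕ) (q : ℕ → K) :
    hyperSum a x n (fun j => c * q j) = c * hyperSum a x n q := by
  simp only [hyperSum, mul_assoc, Finset.mul_sum]

theorem hyperSum_sum {ι : Type*} (a x : K) (n : ℕ) (s : Finset ι) (q : ι → ℕ → K) :
    hyperSum a x n (fun j => ∑ i ∈ s, q i j) = ∑ i ∈ s, hyperSum a x n (q i) := by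
  simp only [hyperSum, Finset.sum_mul]
  exact Finset.sum_comm

/-- The derivative of `(1 - X)^a (1 - xX)^{-a}` is `a (x - 1) (1 - X)^{a-1} (1 - xX)^{-a-1}`. -/
theorem natCast_mul_hyperSum_one [CharZero K] (a x : K) (n : ℕ) :
    (n : K) * hyperSum a x n (fun _ => 1) = a * ((x - 1) * jacobiCoeff a x n) := by
  rcases n with _ | n
  · simp [jacobiCoeff_zero]
  have h0 : hyperSum a x (n + 1) (fun _ => 1) =
      PowerSeries.coeff (n + 1) (risingSeries (-a) * PowerSeries.rescale x (risingSeries a)) := by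
    rw [hyperSum, PowerSeries.coeff_mul]
    refine Finset.sum_congr rfl fun p _ => ?_
    rw [PowerSeries.coeff_rescale, risingSeries, risingSeries, PowerSeries.coeff_mk,
      PowerSeries.coeff_mk]
    ring
  have h1 : d⁄dX K (risingSeries (-a) * PowerSeries.rescale x (risingSeries a)) =
      PowerSeries.C (a * (x - 1)) * jacobiSeries a x := by
    rw [Derivation.leibniz, smul_eq_mul, smul_eq_mul, derivative_rescale_risingSeries,
      derivative_risingSeries, jacobiSeries, neg_add_eq_sub]
    have h2 := one_sub_X_mul_risingSeries (-a)
    rw [neg_add_eq_sub] at h2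
    have h3 := rescale_one_sub_X_mul a x
    simp only [map_sub, map_mul, map_neg, map_one]
    linear_combination (-(PowerSeries.C x * PowerSeries.C a *
      PowerSeries.rescale x (risingSeries (a + 1)))) * h2 +
        PowerSeries.C a * risingSeries (1 - a) * h3
  have h3 := congrArg (PowerSeries.coeff n) h1
  rw [PowerSeries.coeff_derivative, ← h0, PowerSeries.coeff_C_mul, ← jacobiCoeff_succ] at h3
  push_cast
  linear_combination h3

theorem hyperSum_natCast [CharZero K] (a x : K) {n : ℕ} (hn : 1 ≤ n) :
    hyperSum a x n (fun j => (j : K)) =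
      a * (x * jacobiCoeff a x n - x * jacobiCoeff a x (n - 1)) := by
  obtain ⟨k, rfl⟩ : ∃ k, n = k + 1 := ⟨n - 1, by omega⟩
  have h0 : hyperSum a x (k + 1) (fun j => (j : K)) = PowerSeries.coeff (k + 1)
      (risingSeries (-a) * (PowerSeries.X * d⁄dX K (PowerSeries.rescale x (risingSeries a)))) := by
    rw [hyperSum, PowerSeries.coeff_mul]
    refine Finset.sum_congr rfl fun p _ => ?_
    rcases p with ⟨i, _ | j⟩
    · simp
    · simp only [PowerSeries.coeff_succ_X_mul, PowerSeries.coeff_derivative,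
        PowerSeries.coeff_rescale, risingSeries, PowerSeries.coeff_mk]
      push_cast
      ring
  have h1 : risingSeries (-a) * (PowerSeries.X * d⁄dX K (PowerSeries.rescale x (risingSeries a))) =
      PowerSeries.C (a * x) * (PowerSeries.X * jacobiSeries a x -
        PowerSeries.X * (PowerSeries.X * jacobiSeries a x)) := by
    have h2 := one_sub_X_mul_risingSeries (-a)
    rw [neg_add_eq_sub] at h2
    rw [derivative_rescale_risingSeries, jacobiSeries, ← h2, map_mul]
    ring
  rw [h0, h1, PowerSeries.coeff_C_mul, map_sub, PowerSeries.coeff_succ_X_mul,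
    PowerSeries.coeff_succ_X_mul, Nat.add_sub_cancel, jacobiCoeff_succ, ← jacobiCoeff]
  ring

/-- The hypergeometric equation `θ (θ + a - n) g = x (θ + a) (θ - n) g`, `θ = x d/dx`, with
the polynomial `q(θ)` applied to it. -/
theorem hyperSum_equation [CharZero K] (a x : K) (n : ℕ) (q : ℕ → K) :
    hyperSum a x n (fun j => q j * (j * (j + a - n))) =
      x * hyperSum a x n (fun j => q (j + 1) * ((j - n) * (j + a))) := by
  rcases n with _ | n
  · simp [hyperSum]
  simp only [hyperSum]
  rw [Finset.Nat.sum_antidiagonal_succ', Finset.Nat.sum_antidiagonal_succ]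
  simp only [Nat.cast_zero, zero_mul, mul_zero, zero_add, sub_self, Finset.mul_sum]
  refine Finset.sum_congr rfl fun p hp => ?_
  have hp' : p.1 + p.2 = n := Finset.HasAntidiagonal.mem_antidiagonal.1 hp
  subst hp'
  have h1 := risingCoeff_succ a p.2
  have h2 := risingCoeff_succ (-a) p.1
  push_cast
  linear_combination (q (p.2 + 1) * (a - p.1) * risingCoeff (-a) p.1 * x ^ (p.2 + 1)) * h1 +
    (q (p.2 + 1) * (a + p.2) * risingCoeff a p.2 * x ^ (p.2 + 1)) * h2

/-- The hypergeometric equation expresses `θ^{k+2} g` by lower powers of `θ = x d/dx`. -/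
theorem hyperSum_pow_add_two [CharZero K] (a x : K) (n k : ℕ) :
    (1 - x) * hyperSum a x n (fun j => (j : K) ^ (k + 2)) =
      (1 - x) * (n - a) * hyperSum a x n (fun j => (j : K) ^ (k + 1)) -
        x * (n * a * hyperSum a x n (fun j => (j : K) ^ k)) +
        x * ∑ i ∈ Finset.range k, (k.choose i : K) *
          (hyperSum a x n (fun j => (j : K) ^ (i + 2)) +
            (a - n) * hyperSum a x n (fun j => (j : K) ^ (i + 1)) -
            n * a * hyperSum a x n (fun j => (j : K) ^ i)) := by
  have h := hyperSum_equation a x n (fun j => (j : K) ^ k)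
  have hl : (fun j : ℕ => (j : K) ^ k * (j * (j + a - n))) =
      fun j : ℕ => (j : K) ^ (k + 2) + (a - n) * (j : K) ^ (k + 1) := by
    ext j
    ring
  have hr : (fun j : ℕ => ((j + 1 : ℕ) : K) ^ k * ((j - n) * (j + a))) =
      fun j : ℕ => ∑ i ∈ Finset.range (k + 1), (k.choose i : K) *
        ((j : K) ^ (i + 2) + ((a - n) * (j : K) ^ (i + 1) + -(n * a) * (j : K) ^ i)) := by
    ext j
    push_cast
    rw [add_pow, Finset.sum_mul]
    refine Finset.sum_congr rfl fun i _ => ?_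
    ring
  rw [hl, hr, hyperSum_add, hyperSum_sum] at h
  simp only [hyperSum_const_mul, hyperSum_add] at h
  rw [Finset.sum_range_succ, Nat.choose_self] at h
  have e : ∀ i, (k.choose i : K) * (hyperSum a x n (fun j => (j : K) ^ (i + 2)) +
            ((a - n) * hyperSum a x n (fun j => (j : K) ^ (i + 1)) +
            -(n * a) * hyperSum a x n (fun j => (j : K) ^ i))) = (k.choose i : K) *
          (hyperSum a x n (fun j => (j : K) ^ (i + 2)) +
            (a - n) * hyperSum a x n (fun j => (j : K) ^ (i + 1)) -
            n * a * hyperSum a x n (fun j => (j : K) ^ i)) := fun i => by ring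
  simp only [e] at h
  push_cast at h
  linear_combination h

theorem risingCoeff_eq [CharZero K] (α : K) (j : ℕ) :
    risingCoeff α j = (ascPochhammer K j).eval α / (j.factorial : K) := by
  induction j with
  | zero => simp [risingCoeff]
  | succ j ih =>
    have h : (j : K) + 1 ≠ 0 := Nat.cast_add_one_ne_zero j
    have h' : (j.factorial : K) ≠ 0 := Nat.cast_ne_zero.2 (Nat.factorial_ne_zero j)
    refine mul_left_cancel₀ h ?_
    rw [risingCoeff_succ, ih, ascPochhammer_succ_eval, Nat.factorial_succ]
    push_cast
    field_simp

/-- The Jacobi polynomials `𝒫_n^{(a-1-n, 1)}(1 - 2x)` are, up to sign, the coefficients of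
`(1 - X)^{a-1} (1 - xX)^{-a-1}`. -/
theorem jacobi_eq_coeff [CharZero K] (a x α : K) (n : ℕ) (hα : α + n = a - 1) :
    jacobi (n : ℤ) α 1 (1 - 2 * x) = (-1) ^ n * PowerSeries.coeff n (jacobiSeries a x) := by
  have hn : (n.factorial : K) ≠ 0 := Nat.cast_ne_zero.2 (Nat.factorial_ne_zero n)
  rw [jacobi, if_neg (by omega), jacobiSeries, mul_comm (risingSeries _), PowerSeries.coeff_mul,
    Finset.Nat.sum_antidiagonal_eq_sum_range_succ_mk, Int.toNat_natCast, Finset.sum_div,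
    Finset.mul_sum]
  refine Finset.sum_congr rfl fun s hs => ?_
  have hsn : s ≤ n := Nat.lt_succ_iff.1 (Finset.mem_range.1 hs)
  simp only [PowerSeries.coeff_rescale, risingSeries, PowerSeries.coeff_mk, risingCoeff_eq]
  obtain ⟨i, rfl⟩ := Nat.exists_eq_add_of_le hsn
  have hs' : (s.factorial : K) ≠ 0 := Nat.cast_ne_zero.2 (Nat.factorial_ne_zero s)
  have hi' : (i.factorial : K) ≠ 0 := Nat.cast_ne_zero.2 (Nat.factorial_ne_zero i)
  have hch : ((s + i).choose s : K) * s.factorial * i.factorial = (s + i).factorial := by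
    have h := Nat.choose_mul_factorial_mul_factorial hsn
    rw [Nat.add_sub_cancel_left] at h
    exact_mod_cast h
  have hasc : (ascPochhammer K i).eval (1 - a) = (-1) ^ i * (ascPochhammer K i).eval (α + s + 1) := by
    have h1 := ascPochhammer_eval_neg_eq_descPochhammer K (a - 1) i
    rw [descPochhammer_eval_eq_ascPochhammer, neg_sub] at h1
    rw [h1]
    congr 2
    push_cast at hα
    linear_combination -hα
  have e1 : 1 + α + 1 + (((s + i : ℕ) : ℤ) : K) = a + 1 := by
    push_cast at hα ⊢
    linear_combination hα
  rw [Nat.add_sub_cancel_left, hasc, e1, ← hch]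
  have e2 : ((1 - 2 * x - 1) / 2) ^ s = (-1) ^ s * x ^ s := by
    rw [← mul_pow]
    congr 1
    ring
  have e3 : ((-1 : K)) ^ i * (-1) ^ i = 1 := by
    rw [← mul_pow]
    simp
  have hc : ((s + i).choose s : K) ≠ 0 := by
    intro h
    rw [h, zero_mul, zero_mul] at hch
    exact hn hch.symm
  rw [e2, pow_add]
  field_simp
  linear_combination (-(eval (α + (s : K) + 1) (ascPochhammer K i) *
    eval (a + 1) (ascPochhammer K s) * x ^ s)) * e3

theorem xi1_eq [CharZero K] (P Q : ℤ) (t : K) {m : ℕ} (hm : 1 ≤ m) :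
    xi1 P Q t m = -(t ^ ((P - Q) * (m : ℤ)) *
      jacobiCoeff (m * bParam K P Q) ((t ^ Q) ^ 2) m) := by
  obtain ⟨k, rfl⟩ : ∃ k, m = k + 1 := ⟨m - 1, by omega⟩
  have e : ((k + 1 : ℕ) : ℤ) - 1 = (k : ℤ) := by push_cast; ring
  rw [xi1, e, jacobi_eq_coeff (((k + 1 : ℕ) : K) * bParam K P Q) _ _ _ (by push_cast; ring),
    jacobiCoeff_succ]
  have e3 : ((-1 : K)) ^ k * (-1) ^ k = 1 := by
    rw [← mul_pow]
    simp
  rw [pow_succ]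
  linear_combination (-(t ^ ((P - Q) * ((k + 1 : ℕ) : ℤ)) * PowerSeries.coeff k (jacobiSeries
    (((k + 1 : ℕ) : K) * bParam K P Q) ((t ^ Q) ^ 2)))) * e3

theorem xi2_eq [CharZero K] (P Q : ℤ) (t : K) {m : ℕ} (hm : 1 ≤ m) :
    xi2 P Q t m = t ^ ((P - Q) * (m : ℤ)) *
      jacobiCoeff (m * bParam K P Q) ((t ^ Q) ^ 2) (m - 1) := by
  obtain ⟨k, rfl⟩ : ∃ k, m = k + 1 := ⟨m - 1, by omega⟩
  rcases k with _ | k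
  · simp [xi2, jacobi, jacobiCoeff_zero]
  have e : ((k + 1 + 1 : ℕ) : ℤ) - 2 = (k : ℤ) := by push_cast; ring
  rw [xi2, e, jacobi_eq_coeff (((k + 1 + 1 : ℕ) : K) * bParam K P Q) _ _ _ (by push_cast; ring),
    Nat.add_sub_cancel, jacobiCoeff_succ]
  have e3 : ((-1 : K)) ^ k * (-1) ^ k = 1 := by
    rw [← mul_pow]
    simp
  rw [pow_succ, pow_succ]
  linear_combination (t ^ ((P - Q) * ((k + 1 + 1 : ℕ) : ℤ)) * PowerSeries.coeff k (jacobiSeries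
    (((k + 1 + 1 : ℕ) : K) * bParam K P Q) ((t ^ Q) ^ 2))) * e3

end Hypergeometric

/-! ### Reduction to two Jacobi polynomials -/

section PolyComb

variable {K : Type*} [Field K]

/-- For integers `m ≥ m₀`, `F m` is a combination of `f m` and `g m` with coefficients that are
polynomials in `m` of degree at most `d`. -/
def PolyComb (m₀ : ℕ) (f g : ℕ → K) (d : ℕ) (F : ℕ → K) : Prop :=
  ∃ P Q : K[X], P.natDegree ≤ d ∧ Q.natDegree ≤ d ∧
    ∀ m : ℕ, m₀ ≤ m → F m = P.eval (m : K) * f m + Q.eval (m : K) * g m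

variable {m₀ d e : ℕ} {f g F G : ℕ → K}

theorem PolyComb.mono (h : PolyComb m₀ f g d F) (hde : d ≤ e) : PolyComb m₀ f g e F := by
  obtain ⟨P, Q, hP, hQ, hF⟩ := h
  exact ⟨P, Q, hP.trans hde, hQ.trans hde, hF⟩

theorem PolyComb.restrict {m₁ : ℕ} (h : PolyComb m₀ f g d F) (hm : m₀ ≤ m₁) :
    PolyComb m₁ f g d F := by
  obtain ⟨P, Q, hP, hQ, hF⟩ := h
  exact ⟨P, Q, hP, hQ, fun m h => hF m (hm.trans h)⟩

theorem PolyComb.congr (h : PolyComb m₀ f g d F) (hFG : ∀ m, m₀ ≤ m → G m = F m) :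
    PolyComb m₀ f g d G := by
  obtain ⟨P, Q, hP, hQ, hF⟩ := h
  exact ⟨P, Q, hP, hQ, fun m hm => (hFG m hm).trans (hF m hm)⟩

theorem PolyComb.zero : PolyComb m₀ f g d (fun _ => 0) :=
  ⟨0, 0, by simp, by simp, fun m _ => by simp⟩

theorem PolyComb.left : PolyComb m₀ f g d f :=
  ⟨1, 0, by simp, by simp, fun m _ => by simp⟩

theorem PolyComb.right : PolyComb m₀ f g d g :=
  ⟨0, 1, by simp, by simp, fun m _ => by simp⟩

theorem PolyComb.add (hF : PolyComb m₀ f g d F) (hG : PolyComb m₀ f g d G) :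
    PolyComb m₀ f g d (fun m => F m + G m) := by
  obtain ⟨P, Q, hP, hQ, hF⟩ := hF
  obtain ⟨P', Q', hP', hQ', hG⟩ := hG
  refine ⟨P + P', Q + Q', natDegree_add_le_of_degree_le hP hP',
    natDegree_add_le_of_degree_le hQ hQ', fun m hm => ?_⟩
  beta_reduce
  rw [hF m hm, hG m hm, eval_add, eval_add]
  ring

theorem PolyComb.polynomial_mul (hF : PolyComb m₀ f g d F) {R : K[X]} (hR : R.natDegree ≤ e) :
    PolyComb m₀ f g (e + d) (fun m => R.eval (m : K) * F m) := by
  obtain ⟨P, Q, hP, hQ, hF⟩ := hF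
  refine ⟨R * P, R * Q, natDegree_mul_le_of_le hR hP, natDegree_mul_le_of_le hR hQ,
    fun m hm => ?_⟩
  beta_reduce
  rw [hF m hm, eval_mul, eval_mul]
  ring

theorem PolyComb.const_mul (hF : PolyComb m₀ f g d F) (c : K) :
    PolyComb m₀ f g d (fun m => c * F m) := by
  have h := hF.polynomial_mul (R := Polynomial.C c) (e := 0) (by simp)
  simpa using h

theorem PolyComb.linear_mul (hF : PolyComb m₀ f g d F) (r c : K) :
    PolyComb m₀ f g (d + 1) (fun m => (r * m + c) * F m) := by
  have h := hF.polynomial_mul (R := Polynomial.C r * Polynomial.X + Polynomial.C c) (e := 1)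
    (natDegree_linear_le)
  rw [add_comm]
  simpa using h

theorem PolyComb.sub (hF : PolyComb m₀ f g d F) (hG : PolyComb m₀ f g d G) :
    PolyComb m₀ f g d (fun m => F m - G m) := by
  refine (hF.add (hG.const_mul (-1))).congr fun m _ => ?_
  ring

theorem PolyComb.pow_mul (hF : PolyComb m₀ f g d F) (n : ℕ) :
    PolyComb m₀ f g (n + d) (fun m => (m : K) ^ n * F m) := by
  have h := hF.polynomial_mul (R := Polynomial.X ^ n) (e := n) (natDegree_X_pow_le n)
  simpa using h

theorem PolyComb.sum {ι : Type*} (s : Finset ι) {F : ι → ℕ → K}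
    (hF : ∀ i ∈ s, PolyComb m₀ f g d (F i)) : PolyComb m₀ f g d (fun m => ∑ i ∈ s, F i m) := by
  classical
  induction s using Finset.induction_on with
  | empty => simpa using PolyComb.zero
  | insert a s ha ih =>
    refine ((hF a (Finset.mem_insert_self a s)).add
      (ih fun i hi => hF i (Finset.mem_insert_of_mem hi))).congr fun m _ => ?_
    rw [Finset.sum_insert ha]

/-- Change of the two basic functions, at the price of a common denominator `w`. -/
theorem PolyComb.trans {f' g' w : ℕ → K} (hF : PolyComb m₀ f g d F)
    (hf : PolyComb m₀ f' g' e (fun m => w m * f m))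
    (hg : PolyComb m₀ f' g' e (fun m => w m * g m)) :
    PolyComb m₀ f' g' (d + e) (fun m => w m * F m) := by
  obtain ⟨P, Q, hP, hQ, hF⟩ := hF
  refine ((hf.polynomial_mul hP).add (hg.polynomial_mul hQ)).congr fun m hm => ?_
  rw [hF m hm]
  ring

end PolyComb

section Reduction

variable {K : Type*} [Field K] [CharZero K]

/-- The powers `θ^{k+1} g` (`k ≥ 0`) of `θ = x d/dx` applied to the coefficient `g` of `X^n` in
`(1 - X)^a (1 - xX)^{-a}` reduce to `a` times two consecutive Jacobi coefficients; here `a = m b`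
and `n = m + σ`. -/
theorem polyComb_hyperSum_pow {m₀ : ℕ} {b x σ : K} (hx : x ≠ 1) {N : ℕ → ℕ}
    (hN : ∀ m, m₀ ≤ m → (N m : K) = m + σ) (hN1 : ∀ m, m₀ ≤ m → 1 ≤ N m) (k : ℕ) :
    PolyComb m₀ (fun m => m * b * jacobiCoeff (m * b) x (N m))
      (fun m => m * b * jacobiCoeff (m * b) x (N m - 1)) k
      (fun m => hyperSum (m * b) x (N m) (fun j => (j : K) ^ (k + 1))) := by
  induction k using Nat.strong_induction_on with
  | _ k ih =>
  rcases k with _ | k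
  · refine ((PolyComb.left.const_mul x).sub (PolyComb.right.const_mul x)).congr fun m hm => ?_
    simp only [zero_add, pow_one]
    rw [hyperSum_natCast _ _ (hN1 m hm)]
    ring
  -- the lower-order term `n a θ^i g` is of the required form also for `i = 0`
  have hlow : ∀ i ≤ k, PolyComb m₀ (fun m => m * b * jacobiCoeff (m * b) x (N m))
      (fun m => m * b * jacobiCoeff (m * b) x (N m - 1)) (i + 1)
      (fun m => N m * (m * b) * hyperSum (m * b) x (N m) (fun j => (j : K) ^ i)) := by
    intro i hi
    rcases i with _ | i
    · refine (PolyComb.left.linear_mul (d := 0) (b * (x - 1)) 0).congr fun m hm => ?_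
      simp only [pow_zero]
      linear_combination (m * b : K) * natCast_mul_hyperSum_one (m * b) x (N m)
    · refine (((ih i (by omega)).linear_mul b 0).linear_mul 1 σ).congr fun m hm => ?_
      rw [hN m hm]
      ring
  have h1x : 1 - x ≠ 0 := sub_ne_zero.2 (Ne.symm hx)
  have hterm : ∀ i ∈ Finset.range k, PolyComb m₀ (fun m => m * b * jacobiCoeff (m * b) x (N m))
      (fun m => m * b * jacobiCoeff (m * b) x (N m - 1)) (k + 1)
      (fun m => (k.choose i : K) *
          (hyperSum (m * b) x (N m) (fun j => (j : K) ^ (i + 2)) +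
            (m * b - N m) * hyperSum (m * b) x (N m) (fun j => (j : K) ^ (i + 1)) -
            N m * (m * b) * hyperSum (m * b) x (N m) (fun j => (j : K) ^ i))) := by
    intro i hi
    have hi' : i < k := Finset.mem_range.1 hi
    refine ((((((ih (i + 1) (by omega)).add ((ih i (by omega)).linear_mul (b - 1) (-σ))).sub
      (hlow i hi'.le)).const_mul (k.choose i : K)).mono (e := k + 1) (by omega))).congr
        fun m hm => ?_
    rw [hN m hm]
    ring
  refine ((((((ih k (by omega)).linear_mul (1 - b) σ).const_mul (1 - x)).sub
    ((hlow k le_rfl).const_mul x)).add ((PolyComb.sum _ hterm).const_mul x)).const_mul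
      (1 - x)⁻¹).congr fun m hm => ?_
  refine mul_left_cancel₀ h1x ?_
  rw [hyperSum_pow_add_two, mul_inv_cancel_left₀ h1x, hN m hm]
  ring

/-- If `p(m, j)` is a polynomial of total degree `d`, the sum `∑_j p(m, j) g_j x^j` over the terms
of the coefficient `g` of `X^n` reduces to two consecutive Jacobi coefficients, after
multiplication by `n = m + σ`. -/
theorem polyComb_natCast_mul_hyperSum {m₀ : ℕ} {b x σ : K} (hx : x ≠ 1) {N : ℕ → ℕ}
    (hN : ∀ m, m₀ ≤ m → (N m : K) = m + σ) (hN1 : ∀ m, m₀ ≤ m → 1 ≤ N m) {d : ℕ}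
    {p : ℕ → ℕ → K} (hp : p ∈ biPoly K d) :
    PolyComb m₀ (fun m => m * b * jacobiCoeff (m * b) x (N m))
      (fun m => m * b * jacobiCoeff (m * b) x (N m - 1)) d
      (fun m => N m * hyperSum (m * b) x (N m) (p m)) := by
  induction hp using Submodule.span_induction with
  | zero =>
    refine PolyComb.zero.congr fun m _ => ?_
    simp [hyperSum]
  | add p q _ _ hp hq =>
    refine (hp.add hq).congr fun m _ => ?_
    rw [← mul_add, ← hyperSum_add]
    rfl
  | smul c p _ hp =>
    refine (hp.const_mul c).congr fun m _ => ?_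
    have h := hyperSum_const_mul (m * b) x c (N m) (p m)
    rw [mul_left_comm, ← h]
    rfl
  | mem p hp =>
    obtain ⟨α, β, hd, rfl⟩ := hp
    rcases β with _ | β
    · have h : PolyComb m₀ (fun m => m * b * jacobiCoeff (m * b) x (N m))
          (fun m => m * b * jacobiCoeff (m * b) x (N m - 1)) 0 _ := PolyComb.left.const_mul (x - 1)
      refine ((h.pow_mul α).mono (by omega)).congr fun m hm => ?_
      rw [hyperSum_const_mul]
      simp only [pow_zero]
      linear_combination (m : K) ^ α * natCast_mul_hyperSum_one (m * b) x (N m)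
    · refine ((((polyComb_hyperSum_pow (b := b) hx hN hN1 β).linear_mul 1 σ).pow_mul α).mono
        (by omega)).congr fun m hm => ?_
      rw [hyperSum_const_mul, hN m hm]
      ring

/-- For `n = m` no multiplication by `n` is needed if `p` has no constant term. -/
theorem polyComb_hyperSum {b x : K} (hx : x ≠ 1) {d : ℕ} {p : ℕ → ℕ → K} (hp : p ∈ biPoly K d)
    (hp0 : p 0 0 = 0) :
    PolyComb 1 (fun m => m * b * jacobiCoeff (m * b) x m)
      (fun m => m * b * jacobiCoeff (m * b) x (m - 1)) d
      (fun m => hyperSum (m * b) x m (p m)) := by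
  have key : PolyComb 1 (fun m => m * b * jacobiCoeff (m * b) x m)
      (fun m => m * b * jacobiCoeff (m * b) x (m - 1)) d
      (fun m => hyperSum (m * b) x m (fun j => p m j - p 0 0)) := by
    clear hp0
    induction hp using Submodule.span_induction with
    | zero =>
      refine PolyComb.zero.congr fun m _ => ?_
      simp [hyperSum]
    | add p q _ _ hp hq =>
      refine (hp.add hq).congr fun m _ => ?_
      rw [← hyperSum_add]
      congr 1
      ext j
      simp only [Pi.add_apply]
      ring
    | smul c p _ hp =>
      refine (hp.const_mul c).congr fun m _ => ?_
      rw [← hyperSum_const_mul]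
      congr 1
      ext j
      simp only [Pi.smul_apply, smul_eq_mul]
      ring
    | mem p hp =>
      obtain ⟨α, β, hd, rfl⟩ := hp
      rcases β with _ | β
      · rcases α with _ | α
        · refine PolyComb.zero.congr fun m _ => ?_
          simp [hyperSum]
        · have h : PolyComb 1 (fun m => m * b * jacobiCoeff (m * b) x m)
              (fun m => m * b * jacobiCoeff (m * b) x (m - 1)) 0 _ :=
            PolyComb.left.const_mul (x - 1)
          refine ((h.pow_mul α).mono (by omega)).congr fun m hm => ?_
          simp only [Nat.cast_zero, zero_pow (Nat.succ_ne_zero α), zero_mul, sub_zero]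
          rw [hyperSum_const_mul]
          simp only [pow_zero]
          linear_combination (m : K) ^ α * natCast_mul_hyperSum_one (m * b) x m
      · refine (((polyComb_hyperSum_pow (b := b) (σ := 0) (N := fun m => m) hx (fun m _ => by simp)
          (fun m hm => hm) β).pow_mul α).mono (by omega)).congr fun m hm => ?_
        simp only [Nat.cast_zero, zero_pow (Nat.succ_ne_zero β), mul_zero, sub_zero]
        rw [hyperSum_const_mul]
  simpa only [hp0, sub_zero] using key

/-- Raising the degree of the Jacobi coefficients by `s`. The recurrence has no denominator in the
step from `m` to `m + 1`, because its coefficients are divisible by `m`. -/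
theorem polyComb_jacobiCoeff_up (b x : K) (s : ℕ) :
    PolyComb 1 (fun m => jacobiCoeff (m * b) x m) (fun m => jacobiCoeff (m * b) x (m - 1)) s
      (fun m => (∏ j ∈ Finset.Icc 1 s, ((m : K) + j)) * jacobiCoeff (m * b) x (m + s + 1)) ∧
    PolyComb 1 (fun m => jacobiCoeff (m * b) x m) (fun m => jacobiCoeff (m * b) x (m - 1)) s
      (fun m => (∏ j ∈ Finset.Icc 1 s, ((m : K) + j)) * jacobiCoeff (m * b) x (m + s)) := by
  induction s with
  | zero =>
    refine ⟨((PolyComb.left.const_mul (1 + x + b * (x - 1))).sub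
      (PolyComb.right.const_mul x)).congr fun m hm => ?_, PolyComb.left.congr fun m _ => ?_⟩
    · have hm0 : (m : K) ≠ 0 := Nat.cast_ne_zero.2 (by omega)
      refine mul_left_cancel₀ hm0 ?_
      simp only [add_zero, Finset.Icc_eq_empty_of_lt zero_lt_one, Finset.prod_empty, one_mul]
      linear_combination jacobiCoeff_recurrence (m * b) x hm
    · simp
  | succ s ih =>
    obtain ⟨h1, h2⟩ := ih
    refine ⟨((h1.linear_mul (1 + x + b * (x - 1)) ((s + 1) * (1 + x))).sub
      ((h2.linear_mul 1 (s + 1)).const_mul x)).congr fun m hm => ?_,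
      (h1.linear_mul 1 (s + 1)).congr fun m hm => ?_⟩
    · rw [Finset.prod_Icc_succ_top (by omega)]
      have h := jacobiCoeff_recurrence (m * b) x (n := m + (s + 1)) (by omega)
      rw [show m + (s + 1) - 1 = m + s by omega] at h
      push_cast at h ⊢
      rw [← add_assoc m s 1] at h ⊢
      linear_combination (∏ j ∈ Finset.Icc 1 s, ((m : K) + j)) * h
    · rw [Finset.prod_Icc_succ_top (by omega)]
      push_cast
      rw [← add_assoc m s 1]
      ring

/-- Lowering the degree of the Jacobi coefficients by `s`. -/
theorem polyComb_jacobiCoeff_down (b : K) {x : K} (hx : x ≠ 0) (s : ℕ) :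
    PolyComb (s + 1) (fun m => jacobiCoeff (m * b) x m) (fun m => jacobiCoeff (m * b) x (m - 1)) s
      (fun m => (∏ j ∈ Finset.Icc 1 s, ((m : K) - j)) * jacobiCoeff (m * b) x (m - s)) ∧
    PolyComb (s + 1) (fun m => jacobiCoeff (m * b) x m) (fun m => jacobiCoeff (m * b) x (m - 1)) s
      (fun m => (∏ j ∈ Finset.Icc 1 s, ((m : K) - j)) * jacobiCoeff (m * b) x (m - s - 1)) := by
  induction s with
  | zero =>
    refine ⟨PolyComb.left.congr fun m hm => ?_, PolyComb.right.congr fun m _ => ?_⟩ <;> simp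
  | succ s ih =>
    obtain ⟨h1, h2⟩ := ih
    have h1 := h1.restrict (Nat.le_succ _)
    have h2 := h2.restrict (Nat.le_succ _)
    refine ⟨(h2.linear_mul 1 (-(s + 1))).congr fun m hm => ?_,
      (((h2.linear_mul (1 + x + b * (x - 1)) (-((s + 1) * (1 + x)))).sub
      (h1.linear_mul 1 (-(s + 1)))).const_mul x⁻¹).congr fun m hm => ?_⟩
    · rw [Finset.prod_Icc_succ_top (by omega), ← Nat.sub_sub]
      push_cast
      ring
    · rw [Finset.prod_Icc_succ_top (by omega), ← Nat.sub_sub]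
      refine mul_left_cancel₀ hx ?_
      rw [mul_inv_cancel_left₀ hx]
      have h := jacobiCoeff_recurrence (m * b) x (n := m - s - 1) (by omega)
      rw [Nat.sub_add_cancel (by omega)] at h
      have hc : ((m - s - 1 : ℕ) : K) = m - s - 1 := by
        rw [Nat.cast_sub (by omega), Nat.cast_sub (by omega)]
        simp
      rw [hc] at h
      push_cast
      linear_combination (∏ j ∈ Finset.Icc 1 s, ((m : K) - j)) * h

/-- From combinations of Jacobi coefficients to combinations of `ξ¹`, `ξ²`. -/
theorem isXiCombination_of_polyComb (P Q : ℤ) (hP : P ≠ 0) (hQ : Q ≠ 0) (t : K) {m₀ d e D : ℕ}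
    (hm₀ : 1 ≤ m₀) {N : ℕ → ℕ} {F w den val : ℕ → K}
    (hF : PolyComb m₀
      (fun m => m * bParam K P Q * jacobiCoeff (m * bParam K P Q) ((t ^ Q) ^ 2) (N m))
      (fun m => m * bParam K P Q * jacobiCoeff (m * bParam K P Q) ((t ^ Q) ^ 2) (N m - 1)) d F)
    (h1 : PolyComb m₀ (fun m => jacobiCoeff (m * bParam K P Q) ((t ^ Q) ^ 2) m)
      (fun m => jacobiCoeff (m * bParam K P Q) ((t ^ Q) ^ 2) (m - 1)) e
      (fun m => w m * jacobiCoeff (m * bParam K P Q) ((t ^ Q) ^ 2) (N m)))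
    (h2 : PolyComb m₀ (fun m => jacobiCoeff (m * bParam K P Q) ((t ^ Q) ^ 2) m)
      (fun m => jacobiCoeff (m * bParam K P Q) ((t ^ Q) ^ 2) (m - 1)) e
      (fun m => w m * jacobiCoeff (m * bParam K P Q) ((t ^ Q) ^ 2) (N m - 1)))
    (hD : d + e ≤ D) (c : K)
    (hval : ∀ m, m₀ ≤ m → val m = c * (t ^ ((P - Q) * (m : ℤ)) / m * F m) * w m / den m) :
    IsXiCombination P Q t D m₀ den val := by
  have hb0 : bParam K P Q ≠ 0 := div_ne_zero (Int.cast_ne_zero.2 hP) (Int.cast_ne_zero.2 hQ)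
  set b := bParam K P Q with hb
  have hF' : PolyComb m₀ (fun m => jacobiCoeff (m * b) ((t ^ Q) ^ 2) (N m))
      (fun m => jacobiCoeff (m * b) ((t ^ Q) ^ 2) (N m - 1)) d (fun m => F m / (m * b)) := by
    obtain ⟨R, S, hR, hS, h⟩ := hF
    refine ⟨R, S, hR, hS, fun m hm => ?_⟩
    have hm0 : (m : K) ≠ 0 := Nat.cast_ne_zero.2 (by omega)
    beta_reduce
    rw [h m hm]
    field_simp
  obtain ⟨R, S, hR, hS, h⟩ := ((hF'.trans h1 h2).const_mul (c * b)).mono hD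
  refine ⟨-R, S, by rwa [natDegree_neg], hS, fun m hm => ?_⟩
  have hm0 : (m : K) ≠ 0 := Nat.cast_ne_zero.2 (by omega)
  rw [hval m hm, xi1_eq P Q t (hm₀.trans hm), xi2_eq P Q t (hm₀.trans hm), ← hb, eval_neg]
  congr 1
  have hm' := h m hm
  beta_reduce at hm'
  have e1 : c * (t ^ ((P - Q) * (m : ℤ)) / m * F m) * w m =
      t ^ ((P - Q) * (m : ℤ)) * (c * b * (w m * (F m / (m * b)))) := by
    field_simp
  rw [e1, hm']
  ring

end Reduction

/-! ### The coefficients of the operators -/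

section Assembly

variable {K : Type*} [Field K]

/-- The sum over partitions as a power series in `u`. -/
def partitionSeries (P Q : ℤ) (t : K) (m n : ℕ) : K⟦X⟧ :=
  ∑ p ∈ Finset.HasAntidiagonal.antidiagonal n,
    PowerSeries.C (((t ^ Q)⁻¹ ^ p.1 * (t ^ Q) ^ p.2) *
      (risingCoeff (-(m * bParam K P Q)) p.1 * risingCoeff (m * bParam K P Q) p.2)) *
      (zetaCorrection (bParam K P Q) (-(m * bParam K P Q)) p.1 *
        zetaCorrection (bParam K P Q) (m * bParam K P Q) p.2)

theorem algebraMap_eq_coe (r : K) :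
    algebraMap K (LaurentSeries K) r = ((PowerSeries.C r : K⟦X⟧) : LaurentSeries K) := by
  rw [HahnSeries.algebraMap_apply', PowerSeries.algebraMap_apply, Algebra.algebraMap_self_apply]

theorem partitionSum_eq_coe [CharZero K]
    (P Q : ℤ) (hP : P ≠ 0) (hQ : Q ≠ 0) (t : K) (ht : t ≠ 0) (m n : ℕ) :
    partitionSum P Q t m n = ((partitionSeries P Q t m n : K⟦X⟧) : LaurentSeries K) := by
  have hb : bParam K P Q ≠ 0 := div_ne_zero (Int.cast_ne_zero.2 hP) (Int.cast_ne_zero.2 hQ)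
  rw [partitionSum_eq_sum P Q hP hQ t ht, partitionSeries, map_sum]
  refine Finset.sum_congr rfl fun p _ => ?_
  rw [zetaRising_eq hb, zetaRising_eq hb, algebraMap_eq_coe, ← PowerSeries.coe_mul,
    ← PowerSeries.coe_mul]
  congr 1
  simp only [map_mul]
  ring

/-- If `A² = 1` all the `p_i^*` vanish. -/
theorem partitionSum_eq_zero [CharZero K]
    (P Q : ℤ) {t : K} (ht : t ≠ 0) (hx : (t ^ Q) ^ 2 = 1) (m : ℕ) {n : ℕ}
    (hn : 1 ≤ n) : partitionSum P Q t m n = 0 := by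
  have hA : t ^ Q ≠ 0 := zpow_ne_zero _ ht
  have hp : ∀ i, pStar P Q t i = 0 := by
    intro i
    have h : (t ^ Q) ^ i - ((t ^ Q) ^ i)⁻¹ = 0 := by
      rw [sub_eq_zero, ← mul_eq_one_iff_eq_inv₀ (pow_ne_zero _ hA), ← mul_pow, ← sq, hx, one_pow]
    rw [pStar, h, map_zero, zero_div]
  rw [partitionSum]
  simp only [hp, zero_div, zero_mul]
  have h := sum_partition_eq_coeff_of_derivative (fun _ => (0 : LaurentSeries K))
    (G := 1) (S := 0) (by simp) (by simp) (by simp) (by simp) n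
  rw [h, PowerSeries.coeff_one, if_neg (by omega)]

/-- The `u^k`-coefficient of `E_m(u)` times the sum over partitions of `n = m + σ` comes from the
case `u = 0` by inserting a polynomial in `m` and the summation index. -/
theorem exists_coeff_mul_partitionSeries [CharZero K]
    (P Q : ℤ) {t : K} (ht : t ≠ 0) (σ : K) (E : ℕ → K⟦X⟧)
    (hE : ∀ q, (fun m _ : ℕ => PowerSeries.coeff q (E m)) ∈ biPoly K (2 * q)) (k : ℕ) :
    ∃ p ∈ biPoly K (2 * k), (σ = 0 → p 0 0 = PowerSeries.coeff k (E 0)) ∧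
      ∀ m n : ℕ, (n : K) = m + σ → PowerSeries.coeff k (E m * partitionSeries P Q t m n) =
        ((t ^ Q) ^ n)⁻¹ * hyperSum (m * bParam K P Q) ((t ^ Q) ^ 2) n (p m) := by
  set b := bParam K P Q with hb
  set A := t ^ Q with hA
  have hA0 : A ≠ 0 := zpow_ne_zero _ ht
  have hlin : (fun m j : ℕ => (m : K) + σ - j) ∈ biPoly K 1 :=
    Submodule.sub_mem _ (Submodule.add_mem _ natCast_fst_mem_biPoly (const_mem_biPoly σ 1))
      natCast_snd_mem_biPoly
  choose g hg hgeq using fun q => exists_biPoly_subst (coeff_zetaCorrection_mem b (-b) q) hlin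
  let p : ℕ → ℕ → K := fun m j => ∑ r ∈ Finset.HasAntidiagonal.antidiagonal k,
    PowerSeries.coeff r.1 (E m) * ∑ r' ∈ Finset.HasAntidiagonal.antidiagonal r.2,
      g r'.1 m j * PowerSeries.coeff r'.2 (zetaCorrection b (m * b) j)
  have hp : ∀ m i j : ℕ, (i : K) = m + σ - j → p m j = PowerSeries.coeff k
      (E m * (zetaCorrection b (-(m * b)) i * zetaCorrection b (m * b) j)) := by
    intro m i j hij
    simp only [p, PowerSeries.coeff_mul, hgeq _ m j i hij, mul_neg]
  refine ⟨p, ?_, fun hσ => ?_, fun m n hn => ?_⟩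
  · refine sum_mem_biPoly _ fun r hr => ?_
    have hr' : r.1 + r.2 = k := Finset.HasAntidiagonal.mem_antidiagonal.1 hr
    refine biPoly_mono (show 2 * r.1 + 2 * r.2 ≤ 2 * k by omega) (mul_mem_biPoly (hE r.1) ?_)
    refine sum_mem_biPoly _ fun r' hr' => ?_
    have hr'' : r'.1 + r'.2 = r.2 := Finset.HasAntidiagonal.mem_antidiagonal.1 hr'
    exact biPoly_mono (show 2 * r'.1 + 2 * r'.2 ≤ 2 * r.2 by omega)
      (mul_mem_biPoly (hg r'.1) (coeff_zetaCorrection_mem b b r'.2))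
  · rw [hp 0 0 0 (by simp [hσ]), zetaCorrection_zero, zetaCorrection_zero, mul_one, mul_one]
  · rw [partitionSeries, Finset.mul_sum, map_sum, hyperSum, Finset.mul_sum]
    refine Finset.sum_congr rfl fun r hr => ?_
    have hr' : r.1 + r.2 = n := Finset.HasAntidiagonal.mem_antidiagonal.1 hr
    rw [mul_left_comm, PowerSeries.coeff_C_mul, ← hb, ← hA, hp m r.1 r.2]
    · have e : A⁻¹ ^ r.1 * A ^ r.2 = (A ^ n)⁻¹ * (A ^ 2) ^ r.2 := by
        rw [← hr', pow_add, inv_pow]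
        field_simp
        ring
      rw [e]
      ring
    · rw [← hn, ← hr']
      push_cast
      ring

theorem coeff_exp_mem_biPoly [CharZero K] (c : K) (q : ℕ) :
    (fun m _ : ℕ => PowerSeries.coeff q (PowerSeries.rescale ((m : K) * c) (PowerSeries.exp K))) ∈
      biPoly K (2 * q) := by
  have h := const_mul_mem_biPoly (c ^ q * PowerSeries.coeff q (PowerSeries.exp K))
    (pow_mem_biPoly (natCast_fst_mem_biPoly (K := K)) q)
  refine biPoly_mono (show q * 1 ≤ 2 * q by omega) ?_
  convert! h using 1
  ext m _
  rw [PowerSeries.coeff_rescale, mul_pow]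
  ring

theorem coeff_rescale_mem_biPoly (F : K⟦X⟧) (q : ℕ) :
    (fun m _ : ℕ => PowerSeries.coeff q (PowerSeries.rescale (m : K) F)) ∈ biPoly K (2 * q) := by
  have h := const_mul_mem_biPoly (PowerSeries.coeff q F)
    (pow_mem_biPoly (natCast_fst_mem_biPoly (K := K)) q)
  refine biPoly_mono (show q * 1 ≤ 2 * q by omega) ?_
  convert! h using 1
  ext m _
  rw [PowerSeries.coeff_rescale]
  ring

theorem coeff_coe_of_neg (f : K⟦X⟧) {k : ℤ} (hk : k < 0) :
    ((f : K⟦X⟧) : LaurentSeries K).coeff k = 0 := by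
  rw [PowerSeries.coeff_coe, if_pos hk]

theorem coeffE_eq_coe [CharZero K]
    (P Q : ℤ) (hP : P ≠ 0) (hQ : Q ≠ 0) (t : K) (ht : t ≠ 0) (m : ℕ) (l s : ℤ)
    {n : ℕ} (hn : (n : ℤ) = m + s) :
    coeffE P Q t m l s = ((PowerSeries.C (t ^ (P * (m : ℤ)) / (m : K)) *
      (PowerSeries.rescale ((m : K) * ((l : K) + 1 / 2 - (s : K) / 2)) (PowerSeries.exp K) *
        partitionSeries P Q t m n) : K⟦X⟧) : LaurentSeries K) := by
  rw [coeffE, if_pos (by omega), ← hn, Int.toNat_natCast, partitionSum_eq_coe P Q hP hQ t ht,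
    algebraMap_eq_coe, expU, ← PowerSeries.coe_mul, ← PowerSeries.coe_mul]

/-- The pole of `1 / ζ(um)` is of order one, with residue `1 / m`. -/
theorem coeffId_eq_coe [CharZero K] (P Q : ℤ) (hP : P ≠ 0) (hQ : Q ≠ 0) (t : K) (ht : t ≠ 0) {m : ℕ}
    (hm : 1 ≤ m) :
    coeffId P Q t m = HahnSeries.single (-1 : ℤ) (t ^ (P * (m : ℤ)) / (m : K) ^ 2) *
      ((PowerSeries.rescale (m : K) (zetaSeries K)⁻¹ * partitionSeries P Q t m m : K⟦X⟧) :
        LaurentSeries K) := by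
  have hm0 : (m : K) ≠ 0 := Nat.cast_ne_zero.2 (by omega)
  have hS : PowerSeries.rescale (m : K) (zetaSeries K) *
      PowerSeries.rescale (m : K) (zetaSeries K)⁻¹ = 1 := by
    rw [← map_mul, PowerSeries.mul_inv_cancel, map_one]
    rw [constantCoeff_zetaSeries]
    exact one_ne_zero
  have hinv : (zetaU (m : K))⁻¹ = HahnSeries.single (-1 : ℤ) (m : K)⁻¹ *
      ((PowerSeries.rescale (m : K) (zetaSeries K)⁻¹ : K⟦X⟧) : LaurentSeries K) := by
    refine inv_eq_of_mul_eq_one_right ?_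
    rw [zetaU_eq, PowerSeries.coe_mul, PowerSeries.coe_mul, PowerSeries.coe_C, PowerSeries.coe_X]
    have h1 : (HahnSeries.C (m : K) : LaurentSeries K) * HahnSeries.single 1 1 *
        HahnSeries.single (-1 : ℤ) (m : K)⁻¹ = 1 := by
      rw [HahnSeries.C_apply, HahnSeries.single_mul_single, HahnSeries.single_mul_single]
      simp [hm0]
    have h2 : ((PowerSeries.rescale (m : K) (zetaSeries K) : K⟦X⟧) : LaurentSeries K) *
        ((PowerSeries.rescale (m : K) (zetaSeries K)⁻¹ : K⟦X⟧) : LaurentSeries K) = 1 := by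
      rw [← PowerSeries.coe_mul, hS, PowerSeries.coe_one]
    linear_combination h1 + (HahnSeries.C (m : K) : LaurentSeries K) * HahnSeries.single 1 1 *
        HahnSeries.single (-1 : ℤ) (m : K)⁻¹ * h2
  have hsingle : algebraMap K (LaurentSeries K) (t ^ (P * (m : ℤ)) / (m : K)) *
      HahnSeries.single (-1 : ℤ) (m : K)⁻¹ =
        HahnSeries.single (-1 : ℤ) (t ^ (P * (m : ℤ)) / (m : K) ^ 2) := by
    rw [algebraMap_eq_coe, PowerSeries.coe_C, HahnSeries.C_apply, HahnSeries.single_mul_single,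
      zero_add]
    congr 1
    field_simp
  rw [coeffId, hinv, partitionSum_eq_coe P Q hP hQ t ht, ← hsingle, PowerSeries.coe_mul]
  ring

theorem coeff_coeffId [CharZero K] (P Q : ℤ) (hP : P ≠ 0) (hQ : Q ≠ 0) (t : K) (ht : t ≠ 0) {m : ℕ}
    (hm : 1 ≤ m) (k : ℤ) :
    (coeffId P Q t m).coeff k = t ^ (P * (m : ℤ)) / (m : K) ^ 2 *
      ((PowerSeries.rescale (m : K) (zetaSeries K)⁻¹ * partitionSeries P Q t m m : K⟦X⟧) :
        LaurentSeries K).coeff (k + 1) := by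
  rw [coeffId_eq_coe P Q hP hQ t ht hm]
  have h := HahnSeries.coeff_single_mul_add (r := t ^ (P * (m : ℤ)) / (m : K) ^ 2)
    (x := ((PowerSeries.rescale (m : K) (zetaSeries K)⁻¹ * partitionSeries P Q t m m : K⟦X⟧) :
        LaurentSeries K)) (a := k + 1) (b := (-1 : ℤ))
  rwa [add_neg_cancel_right] at h

theorem zpow_mul_inv_pow (P Q : ℤ) {t : K} (ht : t ≠ 0) {m n : ℕ} {s : ℤ} (hn : (n : ℤ) = m + s) :
    t ^ (P * (m : ℤ)) * ((t ^ Q) ^ n)⁻¹ = t ^ (-Q * s) * t ^ ((P - Q) * (m : ℤ)) := by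
  rw [← zpow_natCast, ← zpow_mul, ← zpow_neg, ← zpow_add₀ ht, ← zpow_add₀ ht, hn]
  congr 1
  ring

theorem isXiCombination_zero (P Q : ℤ) (t : K) (d m₀ : ℕ) {den f : ℕ → K}
    (h : ∀ m, m₀ ≤ m → f m = 0) : IsXiCombination P Q t d m₀ den f :=
  ⟨0, 0, by simp, by simp, fun m hm => by simp [h m hm]⟩

theorem IsXiCombination.congr {P Q : ℤ} {t : K} {d m₀ : ℕ} {den f g : ℕ → K}
    (h : IsXiCombination P Q t d m₀ den f) (hfg : ∀ m, m₀ ≤ m → g m = f m) :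
    IsXiCombination P Q t d m₀ den g := by
  obtain ⟨F₁, F₂, h₁, h₂, h⟩ := h
  exact ⟨F₁, F₂, h₁, h₂, fun m hm => (hfg m hm).trans (h m hm)⟩

/-- The reduction of the sums with a polynomial insertion to `ξ¹` and `ξ²`, where `w` clears the
denominators of the contiguity relations. -/
theorem isXiCombination_of_hyperSum [CharZero K]
    (P Q : ℤ) (hP : P ≠ 0) (hQ : Q ≠ 0) {t : K} (ht : t ≠ 0)
    (hx : (t ^ Q) ^ 2 ≠ 1) {m₀ d e D : ℕ} (hm₀ : 1 ≤ m₀) {s : ℤ} {N : ℕ → ℕ}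
    (hN : ∀ m, m₀ ≤ m → (N m : ℤ) = m + s) (hN1 : ∀ m, m₀ ≤ m → 1 ≤ N m)
    {w den val : ℕ → K} {p : ℕ → ℕ → K} (hp : p ∈ biPoly K d)
    (h1 : PolyComb m₀ (fun m => jacobiCoeff (m * bParam K P Q) ((t ^ Q) ^ 2) m)
      (fun m => jacobiCoeff (m * bParam K P Q) ((t ^ Q) ^ 2) (m - 1)) e
      (fun m => w m * jacobiCoeff (m * bParam K P Q) ((t ^ Q) ^ 2) (N m)))
    (h2 : PolyComb m₀ (fun m => jacobiCoeff (m * bParam K P Q) ((t ^ Q) ^ 2) m)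
      (fun m => jacobiCoeff (m * bParam K P Q) ((t ^ Q) ^ 2) (m - 1)) e
      (fun m => w m * jacobiCoeff (m * bParam K P Q) ((t ^ Q) ^ 2) (N m - 1)))
    (hD : d + e ≤ D)
    (hval : ∀ m, m₀ ≤ m → val m = t ^ (P * (m : ℤ)) / m * (((t ^ Q) ^ N m)⁻¹ *
      hyperSum (m * bParam K P Q) ((t ^ Q) ^ 2) (N m) (p m)) * (N m * w m / den m)) :
    IsXiCombination P Q t D m₀ den val := by
  have hNK : ∀ m, m₀ ≤ m → (N m : K) = m + (s : K) := fun m hm => by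
    have h := congrArg (Int.cast : ℤ → K) (hN m hm)
    push_cast at h
    exact h
  refine isXiCombination_of_polyComb P Q hP hQ t hm₀
    (polyComb_natCast_mul_hyperSum hx hNK hN1 hp) h1 h2 hD (t ^ (-Q * s)) fun m hm => ?_
  rw [hval m hm]
  have h := zpow_mul_inv_pow P Q ht (hN m hm)
  linear_combination (hyperSum (m * bParam K P Q) ((t ^ Q) ^ 2) (N m) (p m) * N m * w m /
    (m * den m)) * h

/-- The constant term of the inserted polynomial vanishes for `s = 0`, `k > 0`, because at
`m = j = 0` both the exponential and the correction factors are `1`. -/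
theorem coeff_coeffE_eq [CharZero K]
    (P Q : ℤ) (hP : P ≠ 0) (hQ : Q ≠ 0) {t : K} (ht : t ≠ 0) (l s : ℤ) (k : ℕ) :
    ∃ p ∈ biPoly K (2 * k), (s = 0 → k ≠ 0 → p 0 0 = 0) ∧
      ∀ m n : ℕ, (n : ℤ) = m + s → (coeffE P Q t m l s).coeff (k : ℤ) =
        t ^ (P * (m : ℤ)) / m * (((t ^ Q) ^ n)⁻¹ *
          hyperSum (m * bParam K P Q) ((t ^ Q) ^ 2) n (p m)) := by
  obtain ⟨p, hp, hp0, h⟩ := exists_coeff_mul_partitionSeries P Q ht (s : K) _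
    (coeff_exp_mem_biPoly ((l : K) + 1 / 2 - (s : K) / 2)) k
  refine ⟨p, hp, fun hs hk => ?_, fun m n hn => ?_⟩
  · rw [hp0 (by simp [hs]), PowerSeries.coeff_rescale]
    simp [hk]
  · rw [coeffE_eq_coe P Q hP hQ t ht m l s hn, LaurentSeries.coeff_coe_powerSeries,
      PowerSeries.coeff_C_mul, h m n (by exact_mod_cast congrArg (Int.cast : ℤ → K) hn)]

theorem coeffE_eq_zero [CharZero K]
    (P Q : ℤ) {t : K} (ht : t ≠ 0) (hx : (t ^ Q) ^ 2 = 1) {m : ℕ} (l : ℤ) {s : ℤ}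
    (hs : 1 ≤ m + s) : coeffE P Q t m l s = 0 := by
  rw [coeffE, if_pos (by omega), partitionSum_eq_zero P Q ht hx m (by omega), mul_zero, mul_zero]

theorem isXiCombination_coeffE_nonneg [CharZero K]
    (P Q : ℤ) (hP : P ≠ 0) (hQ : Q ≠ 0) {t : K} (ht : t ≠ 0)
    (l : ℤ) (s k : ℕ) (hsk : (s, k) ≠ (0, 0)) :
    IsXiCombination P Q t (9 * k + 2 + s) 1
      (fun m => ∏ j ∈ Finset.Icc 1 s, ((m : K) + (j : K)))
      (fun m => (coeffE P Q t m l (s : ℤ)).coeff (k : ℤ)) := by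
  by_cases hx : (t ^ Q) ^ 2 = 1
  · refine isXiCombination_zero _ _ _ _ _ fun m hm => ?_
    rw [coeffE_eq_zero P Q ht hx l (by omega), HahnSeries.coeff_zero]
  obtain ⟨p, hp, hp0, h⟩ := coeff_coeffE_eq P Q hP hQ ht l s k
  -- for `s = 0` there is no factor `n = m` in the denominator, so `p 0 0 = 0` is needed
  rcases s with _ | s
  · have hk : k ≠ 0 := fun hk => hsk (by rw [hk])
    refine isXiCombination_of_polyComb P Q hP hQ t (N := fun m => m) (w := fun _ => 1) le_rfl
      (polyComb_hyperSum hx hp (hp0 rfl hk)) (e := 0) ?_ ?_ (by omega) 1 fun m hm => ?_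
    · simpa only [one_mul] using PolyComb.left
    · simpa only [one_mul] using PolyComb.right
    · rw [h m m (by simp)]
      have h' := zpow_mul_inv_pow P Q ht (m := m) (n := m) (s := 0) (by simp)
      rw [mul_zero, zpow_zero] at h'
      simp only [Finset.Icc_eq_empty_of_lt zero_lt_one, Finset.prod_empty]
      linear_combination (hyperSum (m * bParam K P Q) ((t ^ Q) ^ 2) m (p m) / m) * h'
  · obtain ⟨h1, h2⟩ := polyComb_jacobiCoeff_up (bParam K P Q) ((t ^ Q) ^ 2) s
    refine isXiCombination_of_hyperSum P Q hP hQ ht hx le_rfl (s := ((s + 1 : ℕ) : ℤ))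
      (N := fun m => m + s + 1) (fun m _ => by push_cast; ring) (fun m _ => by omega) hp h1 h2
      (by omega) fun m hm => ?_
    rw [h m (m + s + 1) (by push_cast; ring), Finset.prod_Icc_succ_top (by omega)]
    have hne : ∀ j : ℕ, (m : K) + j ≠ 0 := fun j => by
      rw [← Nat.cast_add]
      exact Nat.cast_ne_zero.2 (by omega)
    have hprod : ∏ j ∈ Finset.Icc 1 s, ((m : K) + j) ≠ 0 := Finset.prod_ne_zero_iff.2
      fun j _ => hne j
    have hs := hne (s + 1)
    have e : ((m + s + 1 : ℕ) : K) = (m : K) + ((s + 1 : ℕ) : K) := by push_cast; ring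
    rw [e, mul_comm (∏ j ∈ Finset.Icc 1 s, ((m : K) + j)), div_self (mul_ne_zero hs hprod), mul_one]

theorem isXiCombination_coeffE_zero [CharZero K]
    (P Q : ℤ) (hP : P ≠ 0) (hQ : Q ≠ 0) {t : K} (ht : t ≠ 0)
    (l : ℤ) :
    IsXiCombination P Q t 2 1 (fun m => (m : K)) (fun m => (coeffE P Q t m l 0).coeff 0) := by
  by_cases hx : (t ^ Q) ^ 2 = 1
  · refine isXiCombination_zero _ _ _ _ _ fun m hm => ?_
    rw [coeffE_eq_zero P Q ht hx l (by omega), HahnSeries.coeff_zero]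
  obtain ⟨p, hp, -, h⟩ := coeff_coeffE_eq P Q hP hQ ht l 0 0
  refine isXiCombination_of_hyperSum P Q hP hQ ht hx le_rfl (s := 0) (e := 0)
    (N := fun m => m) (w := fun _ => 1) (fun m _ => by simp) (fun m hm => hm) hp
    ?_ ?_ (by omega) fun m hm => ?_
  · simpa only [one_mul] using PolyComb.left
  · simpa only [one_mul] using PolyComb.right
  · have hm0 : (m : K) ≠ 0 := Nat.cast_ne_zero.2 (by omega)
    have h' := h m m (by simp)
    rw [Nat.cast_zero] at h'
    rw [h', mul_one, div_self hm0, mul_one]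

theorem isXiCombination_coeffE_neg [CharZero K]
    (P Q : ℤ) (hP : P ≠ 0) (hQ : Q ≠ 0) {t : K} (ht : t ≠ 0)
    (l : ℤ) (s k : ℕ) (hs : 1 ≤ s) :
    IsXiCombination P Q t (9 * k + 2 + s) (s + 1)
      (fun m => (∏ j ∈ Finset.Ico 1 s, ((m : K) - (j : K))) * ((m : K) - (s : K)) ^ 2)
      (fun m => (coeffE P Q t m l (-(s : ℤ))).coeff (k : ℤ)) := by
  by_cases hx : (t ^ Q) ^ 2 = 1
  · refine isXiCombination_zero _ _ _ _ _ fun m hm => ?_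
    rw [coeffE_eq_zero P Q ht hx l (by omega), HahnSeries.coeff_zero]
  obtain ⟨p, hp, -, h⟩ := coeff_coeffE_eq P Q hP hQ ht l (-(s : ℤ)) k
  have hx0 : (t ^ Q) ^ 2 ≠ 0 := pow_ne_zero _ (zpow_ne_zero _ ht)
  obtain ⟨h1, h2⟩ := polyComb_jacobiCoeff_down (bParam K P Q) hx0 s
  refine isXiCombination_of_hyperSum P Q hP hQ ht hx (by omega) (s := -(s : ℤ))
    (N := fun m => m - s) (fun m hm => ?_) (fun m _ => by omega) hp h1 h2
    (by omega) fun m hm => ?_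
  · rw [Nat.cast_sub (by omega)]
    ring
  rw [h m (m - s) (by rw [Nat.cast_sub (by omega)]; ring)]
  obtain ⟨r, rfl⟩ : ∃ r, s = r + 1 := ⟨s - 1, by omega⟩
  have hne : ∀ j : ℕ, j ≤ r + 1 → (m : K) - j ≠ 0 := fun j hj => by
    rw [← Nat.cast_sub (by omega)]
    exact Nat.cast_ne_zero.2 (by omega)
  have hprod : ∏ j ∈ Finset.Icc 1 r, ((m : K) - j) ≠ 0 := Finset.prod_ne_zero_iff.2
    fun j hj => hne j ((Finset.mem_Icc.1 hj).2.trans (Nat.le_succ r))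
  have hIco : Finset.Ico 1 (r + 1) = Finset.Icc 1 r := by
    ext j
    simp only [Finset.mem_Ico, Finset.mem_Icc]
    omega
  have hr := hne (r + 1) le_rfl
  rw [Finset.prod_Icc_succ_top (by omega), hIco, Nat.cast_sub (by omega)]
  have e : ((m : K) - ((r + 1 : ℕ) : K)) *
      ((∏ j ∈ Finset.Icc 1 r, ((m : K) - j)) * ((m : K) - ((r + 1 : ℕ) : K))) =
        (∏ j ∈ Finset.Icc 1 r, ((m : K) - j)) * ((m : K) - ((r + 1 : ℕ) : K)) ^ 2 := by ring
  rw [e, div_self (mul_ne_zero hprod (pow_ne_zero _ hr)), mul_one]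

/-- The coefficient of `u^{k-1}` of the identity part. -/
theorem isXiCombination_coeffId [CharZero K]
    (P Q : ℤ) (hP : P ≠ 0) (hQ : Q ≠ 0) {t : K} (ht : t ≠ 0) (k : ℕ) :
    IsXiCombination P Q t (2 * k) 1 (fun m => (m : K) ^ 2)
      (fun m => (coeffId P Q t m).coeff ((k : ℤ) - 1)) := by
  by_cases hx : (t ^ Q) ^ 2 = 1
  · refine isXiCombination_zero _ _ _ _ _ fun m hm => ?_
    rw [coeffId, partitionSum_eq_zero P Q ht hx m hm, mul_zero, mul_zero, HahnSeries.coeff_zero]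
  obtain ⟨p, hp, -, h⟩ := exists_coeff_mul_partitionSeries P Q ht (0 : K) _
    (coeff_rescale_mem_biPoly (zetaSeries K)⁻¹) k
  refine isXiCombination_of_hyperSum P Q hP hQ ht hx le_rfl (s := 0) (e := 0)
    (N := fun m => m) (w := fun _ => 1) (fun m _ => by simp) (fun m hm => hm) hp
    ?_ ?_ (by omega) fun m hm => ?_
  · simpa only [one_mul] using PolyComb.left
  · simpa only [one_mul] using PolyComb.right
  · have hm0 : (m : K) ≠ 0 := Nat.cast_ne_zero.2 (by omega)
    rw [coeff_coeffId P Q hP hQ t ht hm, sub_add_cancel, LaurentSeries.coeff_coe_powerSeries,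
      h m m (by simp)]
    field_simp

theorem coeff_coeffE_of_neg [CharZero K]
    (P Q : ℤ) (hP : P ≠ 0) (hQ : Q ≠ 0) {t : K} (ht : t ≠ 0) (m : ℕ)
    (l s : ℤ) {k : ℤ} (hk : k < 0) : (coeffE P Q t m l s).coeff k = 0 := by
  by_cases hs : 0 ≤ (m : ℤ) + s
  · rw [coeffE_eq_coe P Q hP hQ t ht m l s (Int.toNat_of_nonneg hs), coeff_coe_of_neg _ hk]
  · rw [coeffE, if_neg hs, HahnSeries.coeff_zero]

end Assembly

end AOp

end

theorem proposition6p1 {K : Type*} [Field K] [CharZero K]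
    (P Q : ℤ) (hP : P ≠ 0) (hQ : Q ≠ 0) (t : K) (ht : t ≠ 0) :
    -- the coefficients of the operators exist and are unique
    (∀ m : ℕ, 1 ≤ m →
      ∃! c : LaurentSeries K × (ℤ → ℤ → LaurentSeries K), AOp.IsExpansion P Q t m c.1 c.2) ∧
    ∀ (𝔄₀ : ℕ → LaurentSeries K) (𝔄 : ℕ → ℤ → ℤ → LaurentSeries K),
      (∀ m : ℕ, 1 ≤ m → AOp.IsExpansion P Q t m (𝔄₀ m) (𝔄 m)) →
      -- `s ≥ 0`
      (∀ (l : ℤ) (s k : ℕ), (s, k) ≠ (0, 0) →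
        AOp.IsXiCombination P Q t (9 * k + 2 + s) 1
          (fun m => ∏ j ∈ Finset.Icc 1 s, ((m : K) + (j : K)))
          (fun m => (𝔄 m l (s : ℤ)).coeff (k : ℤ))) ∧
      -- the exceptional coefficient `s = k = 0`
      (∀ l : ℤ, AOp.IsXiCombination P Q t 2 1 (fun m => (m : K))
          (fun m => (𝔄 m l 0).coeff 0)) ∧
      -- negative `s`, written `-s` with `s ≥ 1`; here `m + (-s) ≥ 1`
      (∀ (l : ℤ) (s k : ℕ), 1 ≤ s →
        AOp.IsXiCombination P Q t (9 * k + 2 + s) (s + 1)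
          (fun m => (∏ j ∈ Finset.Ico 1 s, ((m : K) - (j : K))) * ((m : K) - (s : K)) ^ 2)
          (fun m => (𝔄 m l (-(s : ℤ))).coeff (k : ℤ))) ∧
      -- the identity part
      (∀ k : ℕ, AOp.IsXiCombination P Q t (9 * k + 2) 1 (fun m => (m : K) ^ 2)
          (fun m => (𝔄₀ m).coeff (k : ℤ))) ∧
      AOp.IsXiCombination P Q t 0 1 (fun m => (m : K) ^ 2) (fun m => (𝔄₀ m).coeff (-1)) ∧
      -- all the other coefficients in `u` vanish
      (∀ m : ℕ, 1 ≤ m →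
        (∀ (l s k : ℤ), k < 0 → (𝔄 m l s).coeff k = 0) ∧
        (∀ k : ℤ, k < -1 → (𝔄₀ m).coeff k = 0)) := by
  refine ⟨fun m _ => ⟨(AOp.coeffId P Q t m, AOp.coeffE P Q t m), AOp.isExpansion_coeff P Q t m,
    fun c hc => ?_⟩, fun 𝔄₀ 𝔄 h => ?_⟩
  · obtain ⟨h1, h2⟩ := (AOp.isExpansion_iff P Q t m c.1 c.2).1 hc
    exact Prod.ext h1 h2
  have h0 : ∀ m, 1 ≤ m → 𝔄₀ m = AOp.coeffId P Q t m := fun m hm =>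
    ((AOp.isExpansion_iff P Q t m _ _).1 (h m hm)).1
  have h1 : ∀ m, 1 ≤ m → 𝔄 m = AOp.coeffE P Q t m := fun m hm =>
    ((AOp.isExpansion_iff P Q t m _ _).1 (h m hm)).2
  refine ⟨fun l s k hsk => ?_, fun l => ?_, fun l s k hs => ?_, fun k => ?_, ?_, fun m hm => ⟨?_, ?_⟩⟩
  · refine (AOp.isXiCombination_coeffE_nonneg P Q hP hQ ht l s k hsk).congr fun m hm => ?_
    rw [h1 m hm]
  · refine (AOp.isXiCombination_coeffE_zero P Q hP hQ ht l).congr fun m hm => ?_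
    rw [h1 m hm]
  · refine (AOp.isXiCombination_coeffE_neg P Q hP hQ ht l s k hs).congr fun m hm => ?_
    rw [h1 m (by omega)]
  · obtain ⟨F₁, F₂, d₁, d₂, hF⟩ := AOp.isXiCombination_coeffId P Q hP hQ ht (k + 1)
    refine ⟨F₁, F₂, d₁.trans (by omega), d₂.trans (by omega), fun m hm => ?_⟩
    refine Eq.trans ?_ (hF m hm)
    beta_reduce
    rw [h0 m hm]
    congr 1
    push_cast
    ring
  · refine (AOp.isXiCombination_coeffId P Q hP hQ ht 0).congr fun m hm => ?_
    rw [h0 m hm]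
    rfl
  · intro l s k hk
    rw [h1 m hm, AOp.coeff_coeffE_of_neg P Q hP hQ ht m l s hk]
  · intro k hk
    rw [h0 m hm, AOp.coeff_coeffId P Q hP hQ t ht hm, AOp.coeff_coe_of_neg _ (by omega), mul_zero]
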